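/- Let $S^2\subset\mathbb R^3$ be the round unit sphere with area form $\sigma$, let $\lambda$ be the standard Liouville form on $T^*S^2$, let $r$ be the fibre norm on $T^*S^2$ given by the round metric, let $\Sigma(1)=\{r=1\}$ be the unit cotangent bundle and $\pi:\Sigma(1)\to S^2$ the projection. The rotation group $SO(3)$ acts on $T^*S^2$, preserving $\Sigma(1)$, by the canonical transformations induced by rotations of $S^2$. There is an $SO(3)$-invariant smooth one-form $\Pi$ on $\Sigma(1)$ with $d\Pi=\pi^*\sigma$. Extend any such $\Pi$ to the complement of the zero section by pulling it back under the fibrewise radial projection to $\Sigma(1)$. For every $r_0>0$ there is $\delta_0>0$, depending only on $r_0$, such that the following holds for every $0<\delta\le\delta_0$, every such $\Pi$, and every smooth function $f$ with $f(r)=1$ for $0\le r\le r_0$, $f(r)=0$ for all sufficiently large $r$, and $-\delta<f(r)f'(r)<\delta$ for all $r\ge 0$. The two-form $$\Omega=d(\lambda+f(r)\Pi),$$ defined on the complement of the zero section, extends smoothly over the zero section to a symplectic form $\Omega$ on $T^*S^2$, and $\Omega=d\lambda$ where $r$ is sufficiently large. Moreover, $(T^*S^2,\Omega)$ is a filling of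 the standard unit cotangent bundle $(\Sigma(1),\ker\lambda|_{\Sigma(1)})$. Here a symplectic manifold $(W,\Omega)$ is a filling of a compact contact manifold $(Y,\ker\alpha_0)$ (cooriented by $\alpha_0$) if it is convex at infinity with ideal contact boundary $(Y,\ker\alpha_0)$: for some contact form $\alpha=h\alpha_0$ with $h>0$, the positive half $[0,\infty)\times Y$ of the symplectization $(\mathbb R\times Y,d(e^s\alpha))$ embeds symplectically and properly in $W$ such that the complement of the image of $(0,\infty)\times Y$ is compact. -/

import Mathlib

open scoped ContDiff Topology

noncomputable section

namespace MagneticSphere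

/-! ### Differential forms on embedded submanifolds

All manifolds below are embedded submanifolds `M` of a finite dimensional normed space `E`.
A smooth map on `M` is the restriction of a smooth map defined on a neighbourhood of `M`, and a
smooth form on `M` is the restriction (to tangent vectors of `M`) of a smooth form defined on a
neighbourhood of `M`. Since restriction to a submanifold commutes with `d`, the exterior derivative
on `M` of the restriction of `θ` is the restriction of `extDeriv θ`. Two ambient forms
represent the same form on `M` exactly when they satisfy `FormEqOn M`. -/

section Submanifolds

variable {E F : Type*} [NormedAddCommGroup E] [NormedSpace ℝ E]
  [NormedAddCommGroup F] [NormedSpace ℝ F] {k : ℕ}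

/-- Differential `k`-forms on a normed space. -/
abbrev Form (E : Type*) [NormedAddCommGroup E] [NormedSpace ℝ E] (k : ℕ) : Type _ :=
  E → E [⋀^Fin k]→L[ℝ] ℝ

/-- The tangent space of `M` at `x`: velocities at time `0` of smooth curves in `M` through `x`. -/
def tangent (M : Set E) (x : E) : Set E :=
  {v | ∃ γ : ℝ → E, ContDiffAt ℝ ∞ γ 0 ∧ (∀ᶠ t in 𝓝 0, γ t ∈ M) ∧ γ 0 = x ∧ HasDerivAt γ v 0}

/-- `f` is defined and smooth on a neighbourhood of `M`. -/
def SmoothNear (M : Set E) (f : E → F) : Prop :=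
  ∃ U : Set E, IsOpen U ∧ M ⊆ U ∧ ContDiffOn ℝ ∞ f U

/-- `θ` and `η` restrict to the same form on `M`. -/
def FormEqOn (M : Set E) (θ η : Form E k) : Prop :=
  ∀ x ∈ M, ∀ v : Fin k → E, (∀ i, v i ∈ tangent M x) → θ x v = η x v

/-- The pullback `g^* θ`. -/
def pullback (g : E → F) (θ : Form F k) : Form E k :=
  fun x => (θ (g x)).compContinuousLinearMap (fderiv ℝ g x)

/-- `θ` restricts to a symplectic form on `M`: smooth, closed and nondegenerate. -/
def IsSymplecticForm (M : Set E) (θ : Form E 2) : Prop :=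
  SmoothNear M θ ∧ FormEqOn M (extDeriv θ) 0 ∧
    ∀ x ∈ M, ∀ u ∈ tangent M x, (∀ v ∈ tangent M x, θ x ![u, v] = 0) → u = 0

/-- The symplectic form `d(e^s α)` of the symplectization `ℝ × Y`, where `α` is a contact form
on `Y ⊆ E`. -/
def symplectizationForm (α : Form E 1) : Form (ℝ × E) 2 :=
  extDeriv fun q => Real.exp q.1 • pullback Prod.snd α q

/-- `(W, Ω)` is a filling of the compact contact manifold `(Y, ker α₀)`, cooriented by `α₀`, i.e.
`(W, Ω)` is a convex-at-infinity symplectic manifold with ideal contact boundary `(Y, ker α₀)`: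
for some contact form `α = h α₀`, `h > 0`, the positive half `[0, ∞) × Y` of the symplectization
`(ℝ × Y, d(e^s α))` embeds symplectically as the noncompact end of `W`.
The embedding `Φ` is defined on a slightly larger open collar `(-ε, ∞) × Y`; it is a symplectic
diffeomorphism (with inverse `Ψ`) onto an open subset of `W`, the complement of
`Φ((0, ∞) × Y)` is compact, and `Φ(s, y)` leaves every compact subset of `W` as `s → ∞`. -/
def IsFilling (W : Set F) (Ω : Form F 2) (Y : Set E) (α₀ : Form E 1) : Prop :=
  IsSymplecticForm W Ω ∧ IsCompact Y ∧
  ∃ (h : E → ℝ) (ε : ℝ) (Φ : ℝ × E → F) (Ψ : F → ℝ × E),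
    SmoothNear Y h ∧ (∀ y ∈ Y, 0 < h y) ∧ 0 < ε ∧
    SmoothNear (Set.Ioi (-ε) ×ˢ Y) Φ ∧
    SmoothNear (Φ '' (Set.Ioi (-ε) ×ˢ Y)) Ψ ∧
    Set.LeftInvOn Ψ Φ (Set.Ioi (-ε) ×ˢ Y) ∧
    (∃ U : Set F, IsOpen U ∧ Φ '' (Set.Ioi (-ε) ×ˢ Y) = W ∩ U) ∧
    FormEqOn (Set.Ioi (-ε) ×ˢ Y) (pullback Φ Ω) (symplectizationForm fun y => h y • α₀ y) ∧
    IsCompact (W \ Φ '' (Set.Ioi 0 ×ˢ Y)) ∧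
    ∀ K ⊆ W, IsCompact K → ∃ s : ℝ, 0 ≤ s ∧ Disjoint K (Φ '' (Set.Ici s ×ˢ Y))

end Submanifolds

/-! ### The cotangent bundle of the round two-sphere -/

/-- Euclidean three-space. -/
abbrev V : Type := EuclideanSpace ℝ (Fin 3)

/-- The cotangent bundle of the unit sphere `S² ⊆ ℝ³`: pairs `(x, p)` with `x ∈ S²` and `p ⟂ x`,
where `p` stands for the covector `u ↦ ⟪p, u⟫` on the tangent space `x^⊥` of `S²` at `x`. -/
def cotangentSphere : Set (V × V) := {z | ‖z.1‖ = 1 ∧ inner ℝ z.1 z.2 = 0}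

/-- Every covector `ξ` of `S²` at `x` is represented by a unique point `(x, p)` of
`cotangentSphere`, and the norm of `ξ` in the round metric is `‖p‖`. -/
theorem exists_unique_covector (x : V) (hx : ‖x‖ = 1) (ξ : (ℝ ∙ x)ᗮ →L[ℝ] ℝ) :
    ∃! p : V, (x, p) ∈ cotangentSphere ∧ (∀ u : (ℝ ∙ x)ᗮ, ξ u = inner ℝ p (u : V)) ∧
      ‖ξ‖ = ‖p‖ := by
  set q : (ℝ ∙ x)ᗮ := (InnerProductSpace.toDual ℝ _).symm ξ with hq
  have hq' : ∀ u, ξ u = inner ℝ (q : V) (u : V) := fun u => by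
    rw [← Submodule.coe_inner, hq, InnerProductSpace.toDual_symm_apply]
  refine ⟨q, ⟨⟨hx, ?_⟩, hq', ?_⟩, ?_⟩
  · exact (Submodule.mem_orthogonal_singleton_iff_inner_right).1 q.2
  · rw [← Submodule.coe_norm, hq, LinearIsometryEquiv.norm_map]
  · rintro p ⟨⟨-, hp⟩, hp', -⟩
    have hpm : p ∈ (ℝ ∙ x)ᗮ := (Submodule.mem_orthogonal_singleton_iff_inner_right).2 hp
    have : (⟨p, hpm⟩ : (ℝ ∙ x)ᗮ) = q := by
      refine ext_inner_right ℝ fun u => ?_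
      rw [Submodule.coe_inner, Submodule.coe_inner, ← hp', ← hq']
    exact congrArg Subtype.val this

/-- The fibre radius `r` on `T^* S²` for the round metric. -/
def radius (z : V × V) : ℝ := ‖z.2‖

/-- The unit cotangent bundle, `r = 1`. -/
def unitCotangentSphere : Set (V × V) := {z ∈ cotangentSphere | radius z = 1}

/-- The complement of the zero section. -/
def puncturedCotangentSphere : Set (V × V) := {z ∈ cotangentSphere | radius z ≠ 0}

/-- The Liouville form `p dx`, i.e. the covector `p` applied to the projection to the base. -/
def liouvilleForm : Form (V × V) 1 := fun z =>
  ContinuousAlternatingMap.ofSubsingleton ℝ (V × V) ℝ (0 : Fin 1)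
    ((innerSL ℝ z.2).comp (ContinuousLinearMap.fst ℝ V V))

/-- The area form of `S²`: `(u, v) ↦ det (x, u, v)` for `u`, `v` tangent to `S²` at `x`. -/
def areaForm : Form V 2 := fun x =>
  { AlternatingMap.curryLeft ((EuclideanSpace.basisFun (Fin 3) ℝ).toBasis.det) x with
    cont := by
      have h : Continuous fun m : Fin 2 → V =>
          (EuclideanSpace.basisFun (Fin 3) ℝ).toBasis.det (Matrix.vecCons x m) := by
        simp only [Module.Basis.det_apply]
        refine Continuous.matrix_det (continuous_matrix fun i j => ?_)
        refine Fin.cases ?_ (fun j => ?_) j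
        · simpa [Module.Basis.toMatrix_apply] using continuous_const
        · simp only [Module.Basis.toMatrix_apply, Matrix.cons_val_succ,
            OrthonormalBasis.coe_toBasis_repr_apply, EuclideanSpace.basisFun_repr]
          fun_prop
      exact h }

/-- The action of `A ∈ SO(3)` on `T^* S²` by the canonical transformation induced by the rotation
`x ↦ A x`; as `A` is orthogonal, the covector `⟪p, A⁻¹ ·⟫` is represented by `A p`. -/
def rotation (A : Matrix.specialOrthogonalGroup (Fin 3) ℝ) (z : V × V) : V × V :=
  (Matrix.toEuclideanCLM (𝕜 := ℝ) A.1 z.1, Matrix.toEuclideanCLM (𝕜 := ℝ) A.1 z.2)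

/-- `P` is an `SO(3)`-invariant one-form on the unit cotangent bundle with `dP = π^* σ`, where `σ`
is the area form and `π` is the projection to `S²`. -/
def IsInvariantPrimitive (P : Form (V × V) 1) : Prop :=
  SmoothNear unitCotangentSphere P ∧
  FormEqOn unitCotangentSphere (extDeriv P) (pullback Prod.fst areaForm) ∧
  ∀ A, FormEqOn unitCotangentSphere (pullback (rotation A) P) P

/-- Fibrewise radial projection to the unit cotangent bundle. -/
def radialProjection (z : V × V) : V × V := (z.1, (radius z)⁻¹ • z.2)

/-- The one-form `λ + f(r) P` on the complement of the zero section, where `P` is extended from the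
unit cotangent bundle by radial projection. -/
def magneticPrimitive (f : ℝ → ℝ) (P : Form (V × V) 1) : Form (V × V) 1 :=
  fun z => liouvilleForm z + f (radius z) • pullback radialProjection P z

end MagneticSphere

end

open MagneticSphere

/-! `SO(3)` acts simply transitively on the unit cotangent bundle, so an invariant one-form is a
constant combination of the coframe p·dx, (x × p)·dx, (x × p)·dp. The structure equations of this
coframe show that the condition dΠ = π^*σ determines all three constants: Π = -(x × p)·dp, which is
`angularForm` (`IsInvariantPrimitive.eq_angularForm`).

Pulled back radially, Π becomes -r⁻² (x × p)·dp, which is singular at the zero section. Writing f(r)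
= 1 - r² G(r²) splits the primitive into λ + G(r²) (x × p)·dp plus the pullback of Π itself, whose
differential is π^*σ. Hence Ω = d(λ + G(|p|²) (x × p)·dp) + π^*σ. This formula, `magneticForm`,
makes sense everywhere, and G is smooth because f = 1 near zero (`magneticForm_eq_extDeriv`,
`contDiff_profile`).

In a moving orthonormal frame, nondegeneracy of Ω reduces to 1 + f f'/r ≠ 0
(`magneticForm_nondegenerate`). This is clear for r < r₀, where G vanishes, and for r ≥ r₀ it
follows from f f' > -r₀ (`profile_nondegenerate`); so δ₀ = r₀ works. Where f = 0 the form is dλ, and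
fibrewise scaling identifies this end with half of a symplectization (`isFilling_of_eq_liouville`).
-/

noncomputable section

namespace MagneticSphere

/-! ### Forms on embedded submanifolds: restriction, pullback and exterior derivative -/

section Calculus

open Set

variable {E F : Type*} [NormedAddCommGroup E] [NormedSpace ℝ E]
  [NormedAddCommGroup F] [NormedSpace ℝ F] {k : ℕ}

lemma tangent_mono {M N : Set E} (h : M ⊆ N) (x : E) : tangent M x ⊆ tangent N x := by
  rintro v ⟨γ, h1, h2, h3, h4⟩
  exact ⟨γ, h1, h2.mono fun t ht => h ht, h3, h4⟩

lemma mem_tangent_image {M : Set E} {N : Set F} {g : E → F} {x v : E} (hg : ContDiffAt ℝ ∞ g x)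
    (hMN : MapsTo g M N) (hv : v ∈ tangent M x) : fderiv ℝ g x v ∈ tangent N (g x) := by
  obtain ⟨γ, h1, h2, h3, h4⟩ := hv
  subst h3
  exact ⟨g ∘ γ, hg.comp _ h1, h2.mono fun t ht => hMN ht, rfl,
    (hg.differentiableAt (by simp)).hasFDerivAt.comp_hasDerivAt _ h4⟩

lemma pullback_apply (g : E → F) (θ : Form F k) (x : E) (v : Fin k → E) :
    pullback g θ x v = θ (g x) fun i => fderiv ℝ g x (v i) := rfl

lemma FormEqOn.symm {M : Set E} {θ η : Form E k} (h : FormEqOn M θ η) : FormEqOn M η θ :=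
  fun x hx v hv => (h x hx v hv).symm

lemma FormEqOn.trans {M : Set E} {θ η ζ : Form E k} (h : FormEqOn M θ η) (h' : FormEqOn M η ζ) :
    FormEqOn M θ ζ :=
  fun x hx v hv => (h x hx v hv).trans (h' x hx v hv)

lemma FormEqOn.mono {M N : Set E} {θ η : Form E k} (h : FormEqOn N θ η) (hMN : M ⊆ N) :
    FormEqOn M θ η :=
  fun x hx _ hv => h x (hMN hx) _ fun i => tangent_mono hMN x (hv i)

lemma FormEqOn.pullback {M : Set E} {N : Set F} {θ η : Form F k} (h : FormEqOn N θ η)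
    {g : E → F} (hg : ∀ x ∈ M, ContDiffAt ℝ ∞ g x) (hMN : MapsTo g M N) :
    FormEqOn M (pullback g θ) (pullback g η) := fun x hx _ hv =>
  h (g x) (hMN hx) _ fun i => mem_tangent_image (hg x hx) hMN (hv i)

/-- `M` is locally a smooth retract of the ambient space. -/
def LocalRetract (M : Set E) : Prop :=
  ∀ x ∈ M, ∃ (ρ : E → E) (U : Set E), IsOpen U ∧ x ∈ U ∧ ContDiffOn ℝ ∞ ρ U ∧
    MapsTo ρ U M ∧ ∀ w ∈ M, ρ w = w

lemma extDeriv_pullback_eq {g : E → F} {θ : Form F k} {x : E} (hθ : DifferentiableAt ℝ θ (g x))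
    (hg : ContDiffAt ℝ ∞ g x) : extDeriv (pullback g θ) x = pullback g (extDeriv θ) x :=
  extDeriv_pullback hθ hg
    (by rw [minSmoothness_of_isRCLikeNormedField]; exact WithTop.coe_le_coe.2 le_top)

/-- Restriction to a submanifold commutes with the exterior derivative. -/
lemma FormEqOn.extDeriv {M : Set E} (hM : LocalRetract M) {θ η : Form E k}
    (h : FormEqOn M θ η) (hθ : ∀ x ∈ M, DifferentiableAt ℝ θ x)
    (hη : ∀ x ∈ M, DifferentiableAt ℝ η x) : FormEqOn M (extDeriv θ) (extDeriv η) := by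
  intro x hx v hv
  obtain ⟨ρ, U, hU, hxU, hρ, hUM, hid⟩ := hM x hx
  have hat : ∀ w ∈ U, ContDiffAt ℝ ∞ ρ w := fun w hw => hρ.contDiffAt (hU.mem_nhds hw)
  -- Every ambient vector is tangent to the open set `U`, and `ρ` sends it to a vector tangent to
  -- `M`; so the two pullbacks agree as ambient forms near `x`, not only along `M`.
  have hpb : MagneticSphere.pullback ρ θ =ᶠ[𝓝 x] MagneticSphere.pullback ρ η := by
    filter_upwards [hU.mem_nhds hxU] with w hw
    ext u
    have htop : ∀ y, y ∈ tangent U w := fun y => by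
      have hc : ContDiff ℝ ∞ fun t : ℝ => w + t • y := by fun_prop
      refine ⟨fun t => w + t • y, hc.contDiffAt, ?_, by simp, ?_⟩
      · exact hc.continuous.continuousAt.eventually (by simpa using hU.mem_nhds hw)
      · simpa using ((hasDerivAt_id (0 : ℝ)).smul_const y).const_add w
    exact h (ρ w) (hUM hw) _ fun i => mem_tangent_image (hat w hw) hUM (htop (u i))
  -- Since `ρ` fixes `M` pointwise, it fixes curves in `M` and hence their velocities.
  have key : ∀ i, fderiv ℝ ρ x (v i) = v i := fun i => by
    obtain ⟨γ, h1, h2, h3, h4⟩ := hv i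
    have h5 : HasDerivAt (ρ ∘ γ) (fderiv ℝ ρ x (v i)) 0 := by
      subst h3
      exact ((hat _ hxU).differentiableAt (by simp)).hasFDerivAt.comp_hasDerivAt _ h4
    refine h5.unique (h4.congr_of_eventuallyEq ?_)
    filter_upwards [h2] with t ht using hid _ ht
  have := hpb.extDeriv_eq
  rw [extDeriv_pullback_eq (by rw [hid x hx]; exact hθ x hx) (hat x hxU),
    extDeriv_pullback_eq (by rw [hid x hx]; exact hη x hx) (hat x hxU)] at this
  have := congrArg (fun a => a v) this
  simpa only [pullback_apply, key, hid x hx] using this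

/-- The `1`-form given by a family of linear functionals. -/
def oneForm (L : E → E →L[ℝ] ℝ) : Form E 1 := fun z =>
  ContinuousAlternatingMap.ofSubsingleton ℝ E ℝ (0 : Fin 1) (L z)

@[simp] lemma oneForm_apply (L : E → E →L[ℝ] ℝ) (z : E) (v : Fin 1 → E) :
    oneForm L z v = L z (v 0) := rfl

lemma contDiffAt_oneForm {L : E → E →L[ℝ] ℝ} {n : WithTop ℕ∞} {z : E} (hL : ContDiffAt ℝ n L z) :
    ContDiffAt ℝ n (oneForm L) z :=
  (ContinuousAlternatingMap.ofSubsingletonLIE (𝕜 := ℝ) (E := E) (F := ℝ)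
    (0 : Fin 1)).contDiff.contDiffAt.comp z hL

lemma contDiff_oneForm {L : E → E →L[ℝ] ℝ} {n : WithTop ℕ∞} (hL : ContDiff ℝ n L) :
    ContDiff ℝ n (oneForm L) :=
  contDiff_iff_contDiffAt.2 fun _ => contDiffAt_oneForm hL.contDiffAt

/-- The exterior derivative of a `1`-form, via derivatives along straight lines. -/
lemma extDeriv_oneForm {L : E → E →L[ℝ] ℝ} {z u v : E} {c d : ℝ} (hL : DifferentiableAt ℝ L z)
    (hc : HasDerivAt (fun t : ℝ => L (z + t • u) v) c 0)
    (hd : HasDerivAt (fun t : ℝ => L (z + t • v) u) d 0) :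
    extDeriv (oneForm L) z ![u, v] = c - d := by
  have hdiff : DifferentiableAt ℝ (oneForm L) z :=
    (ContinuousAlternatingMap.ofSubsingletonLIE (𝕜 := ℝ) (E := E) (F := ℝ)
      (0 : Fin 1)).differentiable.differentiableAt.comp z hL
  have hline : ∀ a b : E, HasDerivAt (fun t : ℝ => L (z + t • a) b)
      (fderiv ℝ (fun w => L w b) z a) 0 := fun a b => by
    have h1 : HasDerivAt (fun t : ℝ => z + t • a) a 0 := by
      simpa using ((hasDerivAt_id (0 : ℝ)).smul_const a).const_add z
    have h2 : HasFDerivAt (fun w => L w b) (fderiv ℝ (fun w => L w b) z) (z + (0 : ℝ) • a) := by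
      rw [zero_smul, add_zero]
      exact (hL.clm_apply (differentiableAt_const b)).hasFDerivAt
    exact h2.comp_hasDerivAt (0 : ℝ) h1
  rw [extDeriv_apply hdiff, Fin.sum_univ_two, hc.unique (hline u v), hd.unique (hline v u)]
  simp [oneForm_apply, Fin.removeNth, sub_eq_add_neg]

lemma contDiff_extDeriv {θ : Form E k} (hθ : ContDiff ℝ ∞ θ) : ContDiff ℝ ∞ (extDeriv θ) :=
  (ContinuousAlternatingMap.alternatizeUncurryFinCLM ℝ E ℝ).contDiff.comp
    (hθ.fderiv_right (by simp))

lemma SmoothNear.contDiffAt {M : Set E} {f : E → F} (h : SmoothNear M f) {x : E} (hx : x ∈ M) :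
    ContDiffAt ℝ ∞ f x := by
  obtain ⟨U, hU, hMU, hf⟩ := h
  exact hf.contDiffAt (hU.mem_nhds (hMU hx))

lemma smoothNear_of_contDiff {M : Set E} {f : E → F} (h : ContDiff ℝ ∞ f) : SmoothNear M f :=
  ⟨univ, isOpen_univ, subset_univ _, h.contDiffOn⟩

end Calculus

/-! ### Cross products, oriented orthonormal frames and rotations -/

section Cross

/-- The cross product on Euclidean three-space. -/
def cross : V →L[ℝ] V →L[ℝ] V :=
  (LinearMap.mk₂ ℝ (fun x y : V =>
    (!₂[x 1 * y 2 - x 2 * y 1, x 2 * y 0 - x 0 * y 2, x 0 * y 1 - x 1 * y 0] : V))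
    (fun _ _ _ => by ext i; fin_cases i <;> simp <;> ring)
    (fun _ _ _ => by ext i; fin_cases i <;> simp <;> ring)
    (fun _ _ _ => by ext i; fin_cases i <;> simp <;> ring)
    (fun _ _ _ => by ext i; fin_cases i <;> simp <;> ring)).toContinuousBilinearMap

@[simp] lemma cross_zero_coord (x y : V) : cross x y 0 = x 1 * y 2 - x 2 * y 1 := rfl
@[simp] lemma cross_one_coord (x y : V) : cross x y 1 = x 2 * y 0 - x 0 * y 2 := rfl
@[simp] lemma cross_two_coord (x y : V) : cross x y 2 = x 0 * y 1 - x 1 * y 0 := rfl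

lemma inner_eq_coords (x y : V) : inner ℝ x y = x 0 * y 0 + x 1 * y 1 + x 2 * y 2 := by
  simp [PiLp.inner_apply, Fin.sum_univ_three, mul_comm]

lemma ext_coords {x y : V} (h0 : x 0 = y 0) (h1 : x 1 = y 1) (h2 : x 2 = y 2) : x = y := by
  ext i; fin_cases i <;> assumption

@[simp] lemma cross_self (x : V) : cross x x = 0 := by
  apply ext_coords <;> simp <;> ring

lemma cross_swap (x y : V) : cross y x = -cross x y := by
  apply ext_coords <;> simp <;> ring

lemma cross_cross_right (u v w : V) :
    cross u (cross v w) = inner ℝ u w • v - inner ℝ u v • w := by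
  apply ext_coords <;> simp [inner_eq_coords] <;> ring

lemma cross_cross_left (u v w : V) :
    cross (cross u v) w = inner ℝ u w • v - inner ℝ v w • u := by
  apply ext_coords <;> simp [inner_eq_coords] <;> ring

@[simp] lemma inner_cross_left_self (x y : V) : inner ℝ (cross x y) x = 0 := by
  simp [inner_eq_coords]; ring

@[simp] lemma inner_cross_right_self (x y : V) : inner ℝ (cross x y) y = 0 := by
  simp [inner_eq_coords]; ring

lemma inner_cross_cross (u v w z : V) : inner ℝ (cross u v) (cross w z) =
    inner ℝ u w * inner ℝ v z - inner ℝ u z * inner ℝ v w := by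
  simp [inner_eq_coords]; ring

/-- Cramer's rule in dimension three. It serves twice: for an orthonormal frame it is the expansion
of a vector, and paired with a normal vector it makes the triple product of coplanar vectors vanish.
-/
lemma cramer (u v w y : V) : inner ℝ (cross u v) w • y =
    inner ℝ (cross v w) y • u + inner ℝ (cross w u) y • v + inner ℝ (cross u v) y • w := by
  apply ext_coords <;> simp [inner_eq_coords] <;> ring

lemma areaForm_eq (x u v : V) : areaForm x ![u, v] = inner ℝ (cross x u) v := by
  change (EuclideanSpace.basisFun (Fin 3) ℝ).toBasis.det (Matrix.vecCons x ![u, v]) = _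
  rw [Module.Basis.det_apply, Matrix.det_fin_three]
  simp [Module.Basis.toMatrix_apply, inner_eq_coords]
  ring

/-- `(x, q, n)` is a positively oriented orthonormal frame. -/
structure Frame (x q n : V) : Prop where
  xx : inner ℝ x x = 1
  qq : inner ℝ q q = 1
  nn : inner ℝ n n = 1
  xq : inner ℝ x q = 0
  qx : inner ℝ q x = 0
  xn : inner ℝ x n = 0
  nx : inner ℝ n x = 0
  qn : inner ℝ q n = 0
  nq : inner ℝ n q = 0
  cross_xq : cross x q = n
  cross_qx : cross q x = -n
  cross_qn : cross q n = x
  cross_nq : cross n q = -x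
  cross_nx : cross n x = q
  cross_xn : cross x n = -q

lemma Frame.of_inner {x q : V} (xx : inner ℝ x x = 1) (qq : inner ℝ q q = 1)
    (xq : inner ℝ x q = 0) : Frame x q (cross x q) := by
  have qx : inner ℝ q x = 0 := by rw [real_inner_comm, xq]
  have hqn : cross q (cross x q) = x := by rw [cross_cross_right, qq, qx]; simp
  have hnx : cross (cross x q) x = q := by rw [cross_cross_left, xx, qx]; simp
  exact
  { xx, qq, xq, qx
    nn := by rw [inner_cross_cross, xx, qq, xq, qx]; norm_num
    xn := by rw [real_inner_comm, inner_cross_left_self]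
    nx := inner_cross_left_self x q
    qn := by rw [real_inner_comm, inner_cross_right_self]
    nq := inner_cross_right_self x q
    cross_xq := rfl
    cross_qx := cross_swap x q
    cross_qn := hqn
    cross_nq := by rw [cross_swap, hqn]
    cross_nx := hnx
    cross_xn := by rw [cross_swap, hnx] }

lemma Frame.expand {x q n : V} (h : Frame x q n) (w : V) :
    w = inner ℝ x w • x + inner ℝ q w • q + inner ℝ n w • n := by
  have := cramer x q n w
  rwa [h.cross_xq, h.nn, h.cross_qn, h.cross_nx, one_smul] at this

lemma toEuclideanCLM_coord (A : Matrix (Fin 3) (Fin 3) ℝ) (v : V) (i : Fin 3) :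
    Matrix.toEuclideanCLM (𝕜 := ℝ) A v i = A i 0 * v 0 + A i 1 * v 1 + A i 2 * v 2 := by
  simp [Matrix.mulVec, dotProduct, Fin.sum_univ_three]

lemma triple_eq_det (u v w : V) : inner ℝ (cross u v) w =
    (Matrix.of fun i j => (![u, v, w] j : V) i : Matrix (Fin 3) (Fin 3) ℝ).det := by
  rw [Matrix.det_fin_three]
  simp [inner_eq_coords]
  ring

/-- The triple product is a determinant of columns, and `A` multiplies it by `det A = 1`. This is
the source of the invariance of `angularForm`. -/
lemma triple_rotation (A : Matrix.specialOrthogonalGroup (Fin 3) ℝ) (u v w : V) :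
    inner ℝ (cross (Matrix.toEuclideanCLM (𝕜 := ℝ) A.1 u) (Matrix.toEuclideanCLM (𝕜 := ℝ) A.1 v))
      (Matrix.toEuclideanCLM (𝕜 := ℝ) A.1 w) = inner ℝ (cross u v) w := by
  have hA : A.1.det = 1 := (Matrix.mem_specialOrthogonalGroup_iff.1 A.2).2
  rw [triple_eq_det, triple_eq_det]
  have : (Matrix.of fun i j => (![Matrix.toEuclideanCLM (𝕜 := ℝ) A.1 u,
      Matrix.toEuclideanCLM (𝕜 := ℝ) A.1 v, Matrix.toEuclideanCLM (𝕜 := ℝ) A.1 w] j : V) i :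
      Matrix (Fin 3) (Fin 3) ℝ) = A.1 * Matrix.of fun i j => (![u, v, w] j : V) i := by
    ext i j
    rw [Matrix.mul_apply, Fin.sum_univ_three]
    fin_cases j <;> simp only [Matrix.of_apply] <;> exact toEuclideanCLM_coord _ _ _
  rw [this, Matrix.det_mul, hA, one_mul]

/-- The matrix with columns `x, q, n` is orthogonal, and its determinant is the triple product `n·n
= 1`. This gives transitivity of `SO(3)` on oriented orthonormal frames, hence on the unit cotangent
bundle. -/
lemma Frame.exists_rotation {x q n : V} (h : Frame x q n) :
    ∃ A : Matrix.specialOrthogonalGroup (Fin 3) ℝ,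
      Matrix.toEuclideanCLM (𝕜 := ℝ) A.1 (EuclideanSpace.single 0 1) = x ∧
      Matrix.toEuclideanCLM (𝕜 := ℝ) A.1 (EuclideanSpace.single 1 1) = q ∧
      Matrix.toEuclideanCLM (𝕜 := ℝ) A.1 (EuclideanSpace.single 2 1) = n := by
  let M : Matrix (Fin 3) (Fin 3) ℝ := Matrix.of fun i j => (![x, q, n] j : V) i
  have hxx := h.xx
  have hqq := h.qq
  have hnn := h.nn
  have hxq := h.xq
  have hxn := h.xn
  have hqn := h.qn
  rw [inner_eq_coords] at hxx hqq hxq hnn hxn hqn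
  have hM : M ∈ Matrix.specialOrthogonalGroup (Fin 3) ℝ := by
    refine Matrix.mem_specialOrthogonalGroup_iff.2
      ⟨(Matrix.mem_orthogonalGroup_iff' _ _).2 ?_, ?_⟩
    · ext i j
      rw [Matrix.mul_apply, Fin.sum_univ_three]
      fin_cases i <;> fin_cases j <;> simp [M] <;> linarith
    · rw [← h.nn]
      nth_rw 1 [← h.cross_xq]
      rw [triple_eq_det]
  refine ⟨⟨M, hM⟩, ?_, ?_, ?_⟩ <;> apply ext_coords <;> rw [toEuclideanCLM_coord] <;> simp [M]

end Cross

/-! ### The invariant coframe, the area form and the magnetic form in ambient coordinates -/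

section Forms

/-- The functionals `c₁ p·dx + c₂ (x × p)·dx + G(|p|²) (x × p)·dp`. -/
def coframe (c₁ c₂ : ℝ) (G : ℝ → ℝ) (z : V × V) : V × V →L[ℝ] ℝ :=
  c₁ • (innerSL ℝ z.2).comp (ContinuousLinearMap.fst ℝ V V) +
  c₂ • (innerSL ℝ (cross z.1 z.2)).comp (ContinuousLinearMap.fst ℝ V V) +
  G (inner ℝ z.2 z.2) • (innerSL ℝ (cross z.1 z.2)).comp (ContinuousLinearMap.snd ℝ V V)

lemma coframe_apply (c₁ c₂ : ℝ) (G : ℝ → ℝ) (z u : V × V) :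
    coframe c₁ c₂ G z u = c₁ * inner ℝ z.2 u.1 + c₂ * inner ℝ (cross z.1 z.2) u.1 +
      G (inner ℝ z.2 z.2) * inner ℝ (cross z.1 z.2) u.2 := by
  simp [coframe]

lemma contDiffAt_coframe (c₁ c₂ : ℝ) {G : ℝ → ℝ} {z : V × V}
    (hG : ContDiffAt ℝ ∞ G (inner ℝ z.2 z.2)) : ContDiffAt ℝ ∞ (coframe c₁ c₂ G) z := by
  have h2 : ContDiffAt ℝ ∞ (fun w : V × V => G (inner ℝ w.2 w.2)) z :=
    hG.comp z (f := fun w : V × V => (inner ℝ w.2 w.2 : ℝ))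
      (contDiff_snd.inner ℝ contDiff_snd).contDiffAt
  have hs : ContDiff ℝ ∞ (fun v : V => innerSL ℝ v) := by
    rw [contDiff_clm_apply_iff]
    intro y
    exact contDiff_id.inner ℝ contDiff_const
  have hc : ContDiff ℝ ∞ (fun w : V × V => innerSL ℝ (cross w.1 w.2)) := hs.comp (by fun_prop)
  have hp : ContDiff ℝ ∞ (fun w : V × V => innerSL ℝ w.2) := hs.comp (by fun_prop)
  have e1 := hp.contDiffAt (x := z)
  have e2 := hc.contDiffAt (x := z)
  exact (((e1.clm_comp contDiffAt_const).const_smul c₁).add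
    ((e2.clm_comp contDiffAt_const).const_smul c₂)).add
      (h2.smul (e2.clm_comp contDiffAt_const))

lemma contDiff_coframe (c₁ c₂ : ℝ) {G : ℝ → ℝ} (hG : ContDiff ℝ ∞ G) :
    ContDiff ℝ ∞ (coframe c₁ c₂ G) :=
  contDiff_iff_contDiffAt.2 fun _ => contDiffAt_coframe c₁ c₂ hG.contDiffAt

/-- The product rule along a straight line in the ambient space, in the shape that
`extDeriv_oneForm` consumes. The radial coefficient is a function of `|p|²`, which stays
differentiable at `p = 0`. -/
lemma hasDerivAt_coframe_line (c₁ c₂ : ℝ) {G : ℝ → ℝ} {G' : ℝ} {x p a b a' b' : V}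
    (hG : HasDerivAt G G' (inner ℝ p p)) :
    HasDerivAt (fun t : ℝ => coframe c₁ c₂ G ((x, p) + t • (a, b)) (a', b'))
      (c₁ * inner ℝ b a' + c₂ * inner ℝ (cross a p + cross x b) a' +
        (G' * (2 * inner ℝ p b) * inner ℝ (cross x p) b' +
          G (inner ℝ p p) * inner ℝ (cross a p + cross x b) b')) 0 := by
  have line : ∀ y w : V, HasDerivAt (fun t : ℝ => y + t • w) w 0 := fun y w => by
    simpa using ((hasDerivAt_id (0 : ℝ)).smul_const w).const_add y
  have hcross : HasDerivAt (fun t : ℝ => cross (x + t • a) (p + t • b))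
      (cross a p + cross x b) 0 := by
    have h1 : HasDerivAt (fun t : ℝ => cross (x + t • a)) (cross a) 0 :=
      cross.hasFDerivAt.comp_hasDerivAt _ (line x a)
    simpa using h1.clm_apply (line p b)
  have hpp : HasDerivAt (fun t : ℝ => (inner ℝ (p + t • b) (p + t • b) : ℝ))
      (2 * inner ℝ p b) 0 := by
    have := (line p b).inner ℝ (line p b)
    simp only [zero_smul, add_zero] at this
    rwa [real_inner_comm p b, ← two_mul] at this
  have hGc : HasDerivAt (fun t : ℝ => G (inner ℝ (p + t • b) (p + t • b)))
      (G' * (2 * inner ℝ p b)) 0 :=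
    HasDerivAt.comp (0 : ℝ) (h₂ := G) (by simpa using hG) hpp
  have inn : ∀ {g : ℝ → V} {g' : V} (w : V), HasDerivAt g g' 0 →
      HasDerivAt (fun t => (inner ℝ (g t) w : ℝ)) (inner ℝ g' w) 0 := fun w hg => by
    simpa using hg.inner ℝ (hasDerivAt_const (0 : ℝ) w)
  simp only [coframe_apply, Prod.smul_mk, Prod.mk_add_mk]
  have := (((inn a' (line p b)).const_mul c₁).add ((inn a' hcross).const_mul c₂)).add
    (hGc.mul (inn b' hcross))
  simp only [zero_smul, add_zero] at this
  exact this

lemma extDeriv_coframe (c₁ c₂ : ℝ) {G : ℝ → ℝ} {x p : V}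
    (hG : ContDiffAt ℝ ∞ G (inner ℝ p p)) (a b a' b' : V) :
    extDeriv (oneForm (coframe c₁ c₂ G)) (x, p) ![(a, b), (a', b')] =
      c₁ * (inner ℝ b a' - inner ℝ b' a) +
      c₂ * (inner ℝ (cross a p + cross x b) a' - inner ℝ (cross a' p + cross x b') a) +
      2 * deriv G (inner ℝ p p) * (inner ℝ p b * inner ℝ (cross x p) b' -
        inner ℝ p b' * inner ℝ (cross x p) b) +
      G (inner ℝ p p) * (inner ℝ (cross a p + cross x b) b' -
        inner ℝ (cross a' p + cross x b') b) := by
  have hG' : HasDerivAt G (deriv G (inner ℝ p p)) (inner ℝ p p) :=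
    (hG.differentiableAt (by simp)).hasDerivAt
  rw [extDeriv_oneForm ((contDiffAt_coframe c₁ c₂ hG).differentiableAt (by simp))
    (hasDerivAt_coframe_line c₁ c₂ hG') (hasDerivAt_coframe_line c₁ c₂ hG')]
  ring

lemma liouvilleForm_eq : liouvilleForm = oneForm (coframe 1 0 fun _ => 0) := by
  ext z v
  simp only [oneForm_apply, coframe_apply]
  simp [liouvilleForm]

/-- The area form depends linearly on the base point. -/
def areaCLM : V →L[ℝ] V [⋀^Fin 2]→L[ℝ] ℝ :=
  LinearMap.toContinuousLinearMap
    { toFun := areaForm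
      map_add' := fun x y => by
        ext v
        have hv : v = ![v 0, v 1] := by ext i : 1; fin_cases i <;> rfl
        rw [hv, ContinuousAlternatingMap.add_apply, areaForm_eq, areaForm_eq, areaForm_eq, map_add,
          add_apply, inner_add_left]
      map_smul' := fun c x => by
        ext v
        have hv : v = ![v 0, v 1] := by ext i : 1; fin_cases i <;> rfl
        rw [hv, ContinuousAlternatingMap.smul_apply, areaForm_eq, areaForm_eq, map_smul,
          smul_apply, inner_smul_left]
        rfl }

lemma contDiff_areaForm : ContDiff ℝ ∞ areaForm := areaCLM.contDiff

lemma pullback_fst_areaForm : pullback (Prod.fst : V × V → V) areaForm = fun z =>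
    ContinuousAlternatingMap.compContinuousLinearMapCLM (ContinuousLinearMap.fst ℝ V V)
      (areaCLM z.1) := by
  ext z v
  rw [pullback, fderiv_fst]
  rfl

lemma contDiff_pullback_fst_areaForm :
    ContDiff ℝ ∞ (pullback (Prod.fst : V × V → V) areaForm) := by
  rw [pullback_fst_areaForm]
  exact (ContinuousLinearMap.contDiff _).comp (areaCLM.contDiff.comp contDiff_fst)

lemma pullback_fst_areaForm_apply (x p a b a' b' : V) :
    pullback (Prod.fst : V × V → V) areaForm (x, p) ![(a, b), (a', b')] =
      inner ℝ (cross x a) a' := by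
  rw [← areaForm_eq, pullback_apply, fderiv_fst]
  congr 1
  ext i : 1
  fin_cases i <;> rfl

/-- The magnetic two-form with radial profile `G`. -/
def magneticForm (G : ℝ → ℝ) : Form (V × V) 2 := fun z =>
  extDeriv (oneForm (coframe 1 0 G)) z + pullback Prod.fst areaForm z

/-- The singular part of the primitive enters only through its differential π^*σ, so smoothness
across the zero section depends on `G` alone. -/
lemma contDiff_magneticForm {G : ℝ → ℝ} (hG : ContDiff ℝ ∞ G) : ContDiff ℝ ∞ (magneticForm G) :=
  (contDiff_extDeriv (contDiff_oneForm (contDiff_coframe 1 0 hG))).add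
    contDiff_pullback_fst_areaForm

lemma magneticForm_apply {G : ℝ → ℝ} (hG : ContDiff ℝ ∞ G) (x p a b a' b' : V) :
    magneticForm G (x, p) ![(a, b), (a', b')] = inner ℝ b a' - inner ℝ b' a +
      2 * deriv G (inner ℝ p p) * (inner ℝ p b * inner ℝ (cross x p) b' -
        inner ℝ p b' * inner ℝ (cross x p) b) +
      G (inner ℝ p p) * (inner ℝ (cross a p + cross x b) b' -
        inner ℝ (cross a' p + cross x b') b) + inner ℝ (cross x a) a' := by
  rw [magneticForm, ContinuousAlternatingMap.add_apply, extDeriv_coframe 1 0 hG.contDiffAt,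
    pullback_fst_areaForm_apply]
  ring

end Forms

/-! ### Tangent vectors and smooth retractions for the cotangent bundles -/

section Geometry

open Set

/-- Needed on the zero section, where the covector provides no direction `q`. Some `cross x v` is
nonzero, since otherwise all coordinates of `x` would vanish. -/
lemma exists_frame_of_unit {x : V} (hx : ‖x‖ = 1) : ∃ q n, Frame x q n := by
  have hxx : inner ℝ x x = 1 := by rw [real_inner_self_eq_norm_sq, hx]; norm_num
  obtain ⟨v, hv⟩ : ∃ v, cross x v ≠ 0 := by
    by_contra! hcon
    have h0 := hcon (EuclideanSpace.single 0 1)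
    have h1 := hcon (EuclideanSpace.single 1 1)
    have e1 := congrArg (fun y : V => y 1) h0
    have e2 := congrArg (fun y : V => y 2) h0
    have e0 := congrArg (fun y : V => y 2) h1
    simp at e0 e1 e2
    rw [inner_eq_coords, e0, e1, e2] at hxx
    norm_num at hxx
  have hn : ‖cross x v‖ ≠ 0 := norm_ne_zero_iff.2 hv
  refine ⟨‖cross x v‖⁻¹ • cross x v, _, Frame.of_inner hxx ?_ ?_⟩
  · rw [real_inner_self_eq_norm_sq, norm_smul, norm_inv, norm_norm, inv_mul_cancel₀ hn, one_pow]
  · rw [inner_smul_right, real_inner_comm, inner_cross_left_self, mul_zero]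

/-- Points of the cotangent bundle in polar form. -/
lemma exists_frame {z : V × V} (hz : z ∈ cotangentSphere) :
    ∃ q n, Frame z.1 q n ∧ z.2 = radius z • q := by
  obtain ⟨hx, hxp⟩ := hz
  have hxx : inner ℝ z.1 z.1 = 1 := by rw [real_inner_self_eq_norm_sq, hx]; norm_num
  by_cases hp : ‖z.2‖ = 0
  · obtain ⟨q, n, h⟩ := exists_frame_of_unit hx
    exact ⟨q, n, h, by rw [radius, hp, zero_smul, norm_eq_zero.1 hp]⟩
  · refine ⟨‖z.2‖⁻¹ • z.2, _, Frame.of_inner hxx ?_ ?_, ?_⟩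
    · rw [real_inner_self_eq_norm_sq, norm_smul, norm_inv, norm_norm, inv_mul_cancel₀ hp, one_pow]
    · rw [inner_smul_right, hxp, mul_zero]
    · rw [radius, smul_smul, mul_inv_cancel₀ hp, one_smul]

lemma Frame.norm_x {x q n : V} (h : Frame x q n) : ‖x‖ = 1 := by
  rw [norm_eq_sqrt_real_inner, h.xx, Real.sqrt_one]

lemma Frame.norm_q {x q n : V} (h : Frame x q n) : ‖q‖ = 1 := by
  rw [norm_eq_sqrt_real_inner, h.qq, Real.sqrt_one]

/-- The linearised constraints, from differentiating `x·x = 1` and `x·p = 0` along a curve. -/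
lemma tangent_cotangentSphere {x p a b : V} (h : (a, b) ∈ tangent cotangentSphere (x, p)) :
    inner ℝ x a = 0 ∧ inner ℝ p a + inner ℝ x b = 0 := by
  obtain ⟨γ, -, h2, h3, h4⟩ := h
  have hx : HasDerivAt (fun t => (γ t).1) a 0 :=
    (ContinuousLinearMap.fst ℝ V V).hasFDerivAt.comp_hasDerivAt (0 : ℝ) h4
  have hp : HasDerivAt (fun t => (γ t).2) b 0 :=
    (ContinuousLinearMap.snd ℝ V V).hasFDerivAt.comp_hasDerivAt (0 : ℝ) h4
  have k1 := hx.inner ℝ hx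
  have k2 := hx.inner ℝ hp
  rw [h3] at k1 k2
  have c1 : HasDerivAt (fun t => (inner ℝ (γ t).1 (γ t).1 : ℝ)) 0 0 :=
    (hasDerivAt_const (0 : ℝ) (1 : ℝ)).congr_of_eventuallyEq (by
      filter_upwards [h2] with t ht
      rw [real_inner_self_eq_norm_sq, ht.1, one_pow])
  have c2 : HasDerivAt (fun t => (inner ℝ (γ t).1 (γ t).2 : ℝ)) 0 0 :=
    (hasDerivAt_const (0 : ℝ) (0 : ℝ)).congr_of_eventuallyEq (by
      filter_upwards [h2] with t ht
      exact ht.2)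
  have e1 := k1.unique c1
  have e2 := k2.unique c2
  simp only at e1 e2
  rw [real_inner_comm x a] at e1
  rw [real_inner_comm p a] at e2
  exact ⟨by linarith, by linarith⟩

lemma unitCotangentSphere_subset_cotangentSphere : unitCotangentSphere ⊆ cotangentSphere :=
  fun _ hz => hz.1

lemma tangent_unitCotangentSphere {x p a b : V} (h : (a, b) ∈ tangent unitCotangentSphere (x, p)) :
    inner ℝ x a = 0 ∧ inner ℝ p a + inner ℝ x b = 0 ∧ inner ℝ p b = 0 := by
  refine ⟨(tangent_cotangentSphere (tangent_mono
    unitCotangentSphere_subset_cotangentSphere _ h)).1, (tangent_cotangentSphere (tangent_mono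
    unitCotangentSphere_subset_cotangentSphere _ h)).2, ?_⟩
  obtain ⟨γ, -, h2, h3, h4⟩ := h
  have hp : HasDerivAt (fun t => (γ t).2) b 0 :=
    (ContinuousLinearMap.snd ℝ V V).hasFDerivAt.comp_hasDerivAt (0 : ℝ) h4
  have k1 := hp.inner ℝ hp
  rw [h3] at k1
  have c1 : HasDerivAt (fun t => (inner ℝ (γ t).2 (γ t).2 : ℝ)) 0 0 :=
    (hasDerivAt_const (0 : ℝ) (1 : ℝ)).congr_of_eventuallyEq (by
      filter_upwards [h2] with t ht
      have : ‖(γ t).2‖ = 1 := ht.2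
      rw [real_inner_self_eq_norm_sq, this, one_pow])
  have e1 := k1.unique c1
  simp only at e1
  rw [real_inner_comm p b] at e1
  linarith

lemma hasDerivAt_rotate (v w : V) :
    HasDerivAt (fun t : ℝ => Real.cos t • v + Real.sin t • w) w 0 := by
  have := ((Real.hasDerivAt_cos 0).smul_const v).add ((Real.hasDerivAt_sin 0).smul_const w)
  simp only [Real.sin_zero, Real.cos_zero, neg_zero, zero_smul, one_smul, zero_add] at this
  exact this

lemma norm_rotate {v w : V} (hv : inner ℝ v v = 1) (hw : inner ℝ w w = 1) (hvw : inner ℝ v w = 0)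
    (t : ℝ) : ‖Real.cos t • v + Real.sin t • w‖ = 1 := by
  rw [norm_eq_sqrt_real_inner, Real.sqrt_eq_one]
  simp only [inner_add_left, inner_add_right, inner_smul_left, inner_smul_right, hv, hw, hvw,
    real_inner_comm v w]
  simp
  nlinarith [Real.sin_sq_add_cos_sq t]

namespace Frame

variable {x q n : V} (h : Frame x q n)
include h

lemma mem_cotangentSphere (r : ℝ) : (x, r • q) ∈ cotangentSphere :=
  ⟨h.norm_x, by rw [inner_smul_right, h.xq, mul_zero]⟩

lemma mem_unitCotangentSphere : (x, q) ∈ unitCotangentSphere :=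
  ⟨⟨h.norm_x, h.xq⟩, h.norm_q⟩

/-- Rotating the frame around `q`. -/
lemma tangent_transverse {M : Set (V × V)} {r : ℝ}
    (hM : ∀ x' : V, ‖x'‖ = 1 → inner ℝ x' q = 0 → (x', r • q) ∈ M) :
    (n, (0 : V)) ∈ tangent M (x, r • q) := by
  refine ⟨fun t => (Real.cos t • x + Real.sin t • n, r • q), ?_, .of_forall fun t => hM _ ?_ ?_,
    by simp, (hasDerivAt_rotate x n).prodMk (hasDerivAt_const _ _)⟩
  · exact ContDiff.contDiffAt (by fun_prop)
  · exact norm_rotate h.xx h.nn h.xn t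
  · simp [inner_add_left, inner_smul_left, h.xq, h.nq]

/-- The direction of the geodesic flow: rotating the frame around `n`. -/
lemma tangent_geodesic {M : Set (V × V)} {r : ℝ}
    (hM : ∀ x' q' : V, ‖x'‖ = 1 → ‖q'‖ = 1 → inner ℝ x' q' = 0 → (x', r • q') ∈ M) :
    (q, -(r • x)) ∈ tangent M (x, r • q) := by
  have hd : HasDerivAt (fun t : ℝ => r • (Real.cos t • q + Real.sin t • (-x))) (r • (-x)) 0 :=
    (hasDerivAt_rotate q (-x)).const_smul r
  rw [smul_neg] at hd
  refine ⟨fun t => (Real.cos t • x + Real.sin t • q,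
    r • (Real.cos t • q + Real.sin t • (-x))), ?_, .of_forall fun t => hM _ _ ?_ ?_ ?_,
    by simp, (hasDerivAt_rotate x q).prodMk hd⟩
  · exact ContDiff.contDiffAt (by fun_prop)
  · exact norm_rotate h.xx h.qq h.xq t
  · exact norm_rotate h.qq (by simp [h.norm_x]) (by simp [h.qx]) t
  · simp only [inner_add_left, inner_add_right, inner_smul_left, inner_smul_right, inner_neg_right,
      h.xx, h.qq, h.xq, h.qx]
    simp
    ring

/-- Rotating the frame around `x`. -/
lemma tangent_fibre_rotation {M : Set (V × V)} (hM : ∀ q' : V, ‖q'‖ = 1 → inner ℝ x q' = 0 →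
    (x, q') ∈ M) : ((0 : V), n) ∈ tangent M (x, q) := by
  refine ⟨fun t => (x, Real.cos t • q + Real.sin t • n), ?_, .of_forall fun t => hM _ ?_ ?_,
    by simp, (hasDerivAt_const _ _).prodMk (hasDerivAt_rotate q n)⟩
  · exact ContDiff.contDiffAt (by fun_prop)
  · exact norm_rotate h.qq h.nn h.qn t
  · simp [inner_add_right, inner_smul_right, h.xq, h.xn]

end Frame

/-- The vertical directions are tangent to the cotangent bundle. -/
lemma tangent_vertical {x p b : V} (hxp : (x, p) ∈ cotangentSphere) (hb : inner ℝ x b = 0) :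
    ((0 : V), b) ∈ tangent cotangentSphere (x, p) := by
  have line : HasDerivAt (fun t : ℝ => p + t • b) b 0 := by
    simpa using ((hasDerivAt_id (0 : ℝ)).smul_const b).const_add p
  refine ⟨fun t => (x, p + t • b), ContDiff.contDiffAt (by fun_prop), .of_forall fun t =>
    ⟨hxp.1, ?_⟩, by simp, (hasDerivAt_const _ _).prodMk line⟩
  have := hxp.2
  simp only at this
  simp [inner_add_right, inner_smul_right, hb, this]

/-- Smooth retraction onto the cotangent bundle. -/
def cotangentRetraction (z : V × V) : V × V :=
  (‖z.1‖⁻¹ • z.1, z.2 - (inner ℝ (‖z.1‖⁻¹ • z.1) z.2 : ℝ) • ‖z.1‖⁻¹ • z.1)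

lemma contDiffAt_cotangentRetraction {z : V × V} (hz : z.1 ≠ 0) :
    ContDiffAt ℝ ∞ cotangentRetraction z := by
  have h1 : ContDiffAt ℝ ∞ (fun w : V × V => ‖w.1‖⁻¹ • w.1) z :=
    ((contDiffAt_fst.norm ℝ hz).inv (norm_ne_zero_iff.2 hz)).smul contDiffAt_fst
  exact h1.prodMk (contDiffAt_snd.sub ((h1.inner ℝ contDiffAt_snd).smul h1))

lemma cotangentRetraction_mem {z : V × V} (hz : z.1 ≠ 0) :
    cotangentRetraction z ∈ cotangentSphere := by
  have h1 : ‖‖z.1‖⁻¹ • z.1‖ = 1 := by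
    rw [norm_smul, norm_inv, norm_norm, inv_mul_cancel₀ (norm_ne_zero_iff.2 hz)]
  refine ⟨h1, ?_⟩
  simp only [cotangentRetraction, inner_sub_right, inner_smul_right (𝕜 := ℝ)
    (r := inner ℝ (‖z.1‖⁻¹ • z.1) z.2), real_inner_self_eq_norm_sq, h1]
  ring

lemma cotangentRetraction_of_mem {z : V × V} (hz : z ∈ cotangentSphere) :
    cotangentRetraction z = z := by
  simp [cotangentRetraction, hz.1, hz.2]

lemma ne_zero_of_mem {z : V × V} (hz : z ∈ cotangentSphere) : z.1 ≠ 0 := fun h0 => by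
  have := hz.1
  simp [h0] at this

lemma contDiffAt_radialProjection {z : V × V} (hz : z.2 ≠ 0) :
    ContDiffAt ℝ ∞ radialProjection z :=
  contDiffAt_fst.prodMk
    (((contDiffAt_snd.norm ℝ hz).inv (norm_ne_zero_iff.2 hz)).smul contDiffAt_snd)

lemma radialProjection_mem {z : V × V} (hz : z ∈ puncturedCotangentSphere) :
    radialProjection z ∈ unitCotangentSphere := by
  have hr : ‖z.2‖ ≠ 0 := hz.2
  refine ⟨⟨hz.1.1, ?_⟩, ?_⟩
  · simp [radialProjection, inner_smul_right, hz.1.2]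
  · simp [radialProjection, radius, norm_smul, hr]

lemma radialProjection_of_mem {z : V × V} (hz : z ∈ unitCotangentSphere) :
    radialProjection z = z := by
  simp [radialProjection, hz.2]

lemma snd_ne_zero_of_mem {z : V × V} (hz : z ∈ puncturedCotangentSphere) : z.2 ≠ 0 :=
  norm_ne_zero_iff.1 hz.2

lemma unitCotangentSphere_subset_punctured : unitCotangentSphere ⊆ puncturedCotangentSphere :=
  fun z hz => ⟨hz.1, by rw [hz.2]; exact one_ne_zero⟩

lemma isOpen_retractionDomain :
    IsOpen {w : V × V | w.1 ≠ 0 ∧ (cotangentRetraction w).2 ≠ 0} := by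
  have hU : IsOpen {w : V × V | w.1 ≠ 0} := isOpen_ne.preimage continuous_fst
  have hc : ContinuousOn cotangentRetraction {w : V × V | w.1 ≠ 0} := fun w hw =>
    (contDiffAt_cotangentRetraction hw).continuousAt.continuousWithinAt
  exact hc.isOpen_inter_preimage hU (isOpen_ne.preimage continuous_snd)

lemma localRetract_punctured : LocalRetract puncturedCotangentSphere := fun z hz =>
  ⟨cotangentRetraction, _, isOpen_retractionDomain, ⟨ne_zero_of_mem hz.1, by
    rw [cotangentRetraction_of_mem hz.1]; exact snd_ne_zero_of_mem hz⟩,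
    fun _ hw => (contDiffAt_cotangentRetraction hw.1).contDiffWithinAt,
    fun _ hw => ⟨cotangentRetraction_mem hw.1, norm_ne_zero_iff.2 hw.2⟩,
    fun _ hw => cotangentRetraction_of_mem hw.1⟩

lemma localRetract_unit : LocalRetract unitCotangentSphere := fun z hz =>
  ⟨radialProjection ∘ cotangentRetraction, _, isOpen_retractionDomain, ⟨ne_zero_of_mem hz.1, by
    rw [cotangentRetraction_of_mem hz.1]
    exact snd_ne_zero_of_mem (unitCotangentSphere_subset_punctured hz)⟩,
    fun _ hw => ((contDiffAt_radialProjection hw.2).comp _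
      (contDiffAt_cotangentRetraction hw.1)).contDiffWithinAt,
    fun _ hw => radialProjection_mem ⟨cotangentRetraction_mem hw.1, norm_ne_zero_iff.2 hw.2⟩,
    fun _ hw => by
      rw [Function.comp_apply, cotangentRetraction_of_mem hw.1, radialProjection_of_mem hw]⟩

end Geometry

/-! ### Existence and uniqueness of the invariant primitive of the area form -/

section InvariantPrimitive

open Set

/-- The angular form `-(x × p)·dp`, the primitive of the area form. -/
def angularForm : Form (V × V) 1 := oneForm (coframe 0 0 fun _ => -1)

lemma fderiv_rotation (A : Matrix.specialOrthogonalGroup (Fin 3) ℝ) (z u : V × V) :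
    fderiv ℝ (rotation A) z u = rotation A u := by
  have : rotation A = (Matrix.toEuclideanCLM (𝕜 := ℝ) A.1).prodMap
    (Matrix.toEuclideanCLM (𝕜 := ℝ) A.1) := rfl
  rw [this, ContinuousLinearMap.fderiv]

lemma exists_frame_of_mem_unit {z : V × V} (hz : z ∈ unitCotangentSphere) :
    ∃ n, Frame z.1 z.2 n := by
  obtain ⟨q, n, h, hq⟩ := exists_frame hz.1
  rw [hz.2, one_smul] at hq
  exact ⟨n, hq ▸ h⟩

lemma Frame.exists_coords {x q n a b : V} (h : Frame x q n)
    (hab : (a, b) ∈ tangent unitCotangentSphere (x, q)) :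
    ∃ s c t : ℝ, a = s • q + c • n ∧ b = -(s • x) + t • n := by
  obtain ⟨h1, h2, h3⟩ := tangent_unitCotangentSphere hab
  refine ⟨inner ℝ q a, inner ℝ n a, inner ℝ n b, ?_, ?_⟩
  · conv_lhs => rw [h.expand a, h1]
    simp
  · conv_lhs => rw [h.expand b, h3, show inner ℝ x b = -inner ℝ q a by linarith]
    simp

/-- The structure equations of `SO(3)`: with α = p·dx, β = (x × p)·dx, γ = (x × p)·dp, one has dα =
γ ∧ β, dβ = α ∧ γ, dγ = -α ∧ β. The right-hand sides are linearly independent, which forces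
uniqueness, and α ∧ β is π^*σ, which gives existence. -/
lemma extDeriv_coframe_frame {x q n : V} (h : Frame x q n) (c₁ c₂ c₃ s c t s' c' t' : ℝ) :
    extDeriv (oneForm (coframe c₁ c₂ fun _ => c₃)) (x, q)
      ![(s • q + c • n, -(s • x) + t • n), (s' • q + c' • n, -(s' • x) + t' • n)] =
    c₁ * (t * c' - t' * c) + c₂ * (s * t' - s' * t) - c₃ * (s * c' - s' * c) := by
  rw [extDeriv_coframe c₁ c₂ contDiffAt_const]
  simp only [map_add, map_neg, map_smul, add_apply, smul_apply, inner_add_left,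
    inner_add_right, inner_neg_left, inner_neg_right, inner_smul_left, inner_smul_right, h.xx, h.qq,
    h.nn, h.xq, h.qx, h.xn, h.nx, h.qn, h.nq, h.cross_xq, h.cross_nq, h.cross_xn, cross_self,
    inner_zero_left, deriv_const, smul_neg]
  simp
  ring

lemma pair_eta {α : Type*} (v : Fin 2 → α) : v = ![v 0, v 1] := by
  ext i : 1; fin_cases i <;> rfl

lemma contDiff_angularForm : ContDiff ℝ ∞ angularForm :=
  contDiff_oneForm (contDiff_coframe 0 0 contDiff_const)

lemma pullback_fst_areaForm_frame {x q n : V} (h : Frame x q n) (s c s' c' : ℝ) (b b' : V) :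
    pullback (Prod.fst : V × V → V) areaForm (x, q)
      ![(s • q + c • n, b), (s' • q + c' • n, b')] = s * c' - s' * c := by
  rw [pullback_fst_areaForm_apply]
  simp only [map_add, map_smul, inner_add_left, inner_add_right, inner_neg_left, inner_smul_left,
    inner_smul_right, h.qq, h.nn, h.qn, h.nq, h.cross_xq, h.cross_xn]
  simp
  ring

lemma isInvariantPrimitive_angularForm : IsInvariantPrimitive angularForm := by
  refine ⟨smoothNear_of_contDiff contDiff_angularForm, ?_, ?_⟩
  · rintro ⟨x, q⟩ hz v hv
    obtain ⟨n, h⟩ := exists_frame_of_mem_unit hz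
    rw [pair_eta v]
    have h0 := hv 0
    have h1 := hv 1
    generalize v 0 = u at h0 ⊢
    generalize v 1 = w at h1 ⊢
    obtain ⟨s, c, t, ha, hb⟩ := h.exists_coords (a := u.1) (b := u.2) h0
    obtain ⟨s', c', t', ha', hb'⟩ := h.exists_coords (a := w.1) (b := w.2) h1
    rw [show u = (u.1, u.2) from rfl, show w = (w.1, w.2) from rfl, ha, hb, ha', hb']
    simp only at h
    rw [angularForm, extDeriv_coframe_frame h, pullback_fst_areaForm_frame h]
    ring
  · intro A z _ v _
    rw [pullback_apply, angularForm, oneForm_apply, oneForm_apply, fderiv_rotation, coframe_apply,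
      coframe_apply]
    simp only [rotation, triple_rotation]
    ring

/-- The frame of the unit cotangent bundle dual to the forms `p·dx`, `(x × p)·dx`,
`(x × p)·dp`. -/
lemma Frame.tangent_unit {x q n : V} (h : Frame x q n) :
    (q, -x) ∈ tangent unitCotangentSphere (x, q) ∧
    (n, (0 : V)) ∈ tangent unitCotangentSphere (x, q) ∧
    ((0 : V), n) ∈ tangent unitCotangentSphere (x, q) := by
  refine ⟨?_, ?_, ?_⟩
  · have := h.tangent_geodesic (r := 1) (M := unitCotangentSphere) fun x' q' h1 h2 h3 =>
      ⟨⟨h1, by simpa using h3⟩, by simpa [radius] using h2⟩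
    simpa using this
  · have := h.tangent_transverse (r := 1) (M := unitCotangentSphere) fun x' h1 h2 =>
      ⟨⟨h1, by simpa using h2⟩, by simpa [radius] using h.norm_q⟩
    simpa using this
  · exact h.tangent_fibre_rotation fun q' h1 h2 => ⟨⟨h.norm_x, h2⟩, h1⟩

lemma standardFrame : Frame (EuclideanSpace.single 0 1) (EuclideanSpace.single 1 1)
    (EuclideanSpace.single 2 1) := by
  have h := Frame.of_inner (x := EuclideanSpace.single 0 1) (q := EuclideanSpace.single 1 1)
    (by simp) (by simp) (by simp [inner_eq_coords])
  rwa [show cross (EuclideanSpace.single 0 1) (EuclideanSpace.single 1 1) =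
    EuclideanSpace.single 2 1 by apply ext_coords <;> simp] at h

/-- An invariant form has constant coefficients in the invariant frame. -/
lemma Frame.invariant_apply {P : Form (V × V) 1}
    (hP : ∀ A, FormEqOn unitCotangentSphere (pullback (rotation A) P) P) {x q n : V}
    (h : Frame x q n) : ∀ s c t : ℝ, P (x, q) ![(s • q + c • n, -(s • x) + t • n)] =
      s * P (EuclideanSpace.single 0 1, EuclideanSpace.single 1 1)
        ![(EuclideanSpace.single 1 1, -EuclideanSpace.single 0 1)] +
      c * P (EuclideanSpace.single 0 1, EuclideanSpace.single 1 1)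
        ![(EuclideanSpace.single 2 1, 0)] +
      t * P (EuclideanSpace.single 0 1, EuclideanSpace.single 1 1)
        ![(0, EuclideanSpace.single 2 1)] := by
  obtain ⟨A, hA0, hA1, hA2⟩ := h.exists_rotation
  have e := standardFrame
  -- Invariance under the rotation carrying the standard frame to `(x, q, n)` transports the values
  -- of `P` from one base point to every other.
  have key : ∀ u ∈ tangent unitCotangentSphere
      ((EuclideanSpace.single 0 1 : V), (EuclideanSpace.single 1 1 : V)),
      P (x, q) ![rotation A u] =
        P (EuclideanSpace.single 0 1, EuclideanSpace.single 1 1) ![u] := by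
    intro u hu
    have := hP A _ e.mem_unitCotangentSphere ![u] (by simpa using hu)
    rw [pullback_apply] at this
    rw [← this, show rotation A (EuclideanSpace.single 0 1, EuclideanSpace.single 1 1) = (x, q) by
      rw [rotation, hA0, hA1]]
    congr 1
    ext i : 1
    fin_cases i
    simp [fderiv_rotation]
  obtain ⟨t1, t2, t3⟩ := e.tangent_unit
  rw [← key _ t1, ← key _ t2, ← key _ t3]
  simp only [rotation, map_neg, map_zero, hA0, hA1, hA2]
  intro s c t
  have upd : ∀ u w : V × V, Function.update ![u] 0 w = ![w] := fun u w => by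
    ext i : 1
    fin_cases i
    rfl
  have lin : ∀ (a : ℝ) (u : V × V), a * P (x, q) ![u] = P (x, q) ![a • u] := fun a u => by
    have := (P (x, q)).map_update_smul ![u] 0 a u
    rw [upd, upd] at this
    exact this.symm
  have add : ∀ u w : V × V, P (x, q) ![u] + P (x, q) ![w] = P (x, q) ![u + w] := fun u w => by
    have := (P (x, q)).map_update_add ![u] 0 u w
    rw [upd, upd, upd] at this
    exact this.symm
  rw [lin, lin, lin, add, add]
  simp

/-- The invariant primitive is unique. -/
lemma IsInvariantPrimitive.eq_angularForm {P : Form (V × V) 1} (hP : IsInvariantPrimitive P) :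
    FormEqOn unitCotangentSphere P angularForm := by
  obtain ⟨hs, hd, hinv⟩ := hP
  generalize hc₁ : P (EuclideanSpace.single 0 1, EuclideanSpace.single 1 1)
        ![(EuclideanSpace.single 1 1, -EuclideanSpace.single 0 1)] = c₁
  generalize hc₂ : P (EuclideanSpace.single 0 1, EuclideanSpace.single 1 1)
        ![(EuclideanSpace.single 2 1, 0)] = c₂
  generalize hc₃ : P (EuclideanSpace.single 0 1, EuclideanSpace.single 1 1)
        ![(0, EuclideanSpace.single 2 1)] = c₃
  have hP' : FormEqOn unitCotangentSphere P (oneForm (coframe c₁ c₂ fun _ => c₃)) := by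
    rintro ⟨x, q⟩ hz v hv
    obtain ⟨n, h⟩ := exists_frame_of_mem_unit hz
    simp only at h
    have h0 := hv 0
    rw [show v = ![v 0] by ext i : 1; fin_cases i; rfl]
    generalize v 0 = u at h0 ⊢
    obtain ⟨s, c, t, ha, hb⟩ := h.exists_coords (a := u.1) (b := u.2) h0
    rw [show u = (u.1, u.2) from rfl, ha, hb, h.invariant_apply hinv, hc₁, hc₂, hc₃, oneForm_apply,
      coframe_apply]
    simp only [Matrix.cons_val_zero, inner_add_right, inner_neg_right, inner_smul_right, h.cross_xq,
      h.qq, h.qn, h.nn, h.nq, h.nx]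
    ring
  have hd' : FormEqOn unitCotangentSphere (extDeriv (oneForm (coframe c₁ c₂ fun _ => c₃)))
      (pullback Prod.fst areaForm) :=
    (FormEqOn.extDeriv localRetract_unit hP' (fun x hx => (hs.contDiffAt hx).differentiableAt
      (by simp)) fun x _ => (contDiff_oneForm (contDiff_coframe c₁ c₂ contDiff_const)).contDiffAt
      |>.differentiableAt (by simp)).symm.trans hd
  have e := standardFrame
  obtain ⟨t1, t2, t3⟩ := e.tangent_unit
  have comp : ∀ s c t s' c' t' : ℝ,
      (s • (EuclideanSpace.single 1 1 : V) + c • (EuclideanSpace.single 2 1 : V),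
        -(s • (EuclideanSpace.single 0 1 : V)) + t • (EuclideanSpace.single 2 1 : V)) ∈
        tangent unitCotangentSphere
          ((EuclideanSpace.single 0 1 : V), (EuclideanSpace.single 1 1 : V)) →
      (s' • (EuclideanSpace.single 1 1 : V) + c' • (EuclideanSpace.single 2 1 : V),
        -(s' • (EuclideanSpace.single 0 1 : V)) + t' • (EuclideanSpace.single 2 1 : V)) ∈
        tangent unitCotangentSphere
          ((EuclideanSpace.single 0 1 : V), (EuclideanSpace.single 1 1 : V)) →
      c₁ * (t * c' - t' * c) + c₂ * (s * t' - s' * t) - c₃ * (s * c' - s' * c) =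
        s * c' - s' * c := by
    intro s c t s' c' t' h1 h2
    rw [← extDeriv_coframe_frame e, hd' _ e.mem_unitCotangentSphere _ (by
      intro i; fin_cases i; exacts [h1, h2]), pullback_fst_areaForm_frame e]
  -- Each pair of dual frame vectors isolates one coefficient: these three give `c₃ = -1`, `c₂ = 0`
  -- and `c₁ = 0`.
  have e1 := comp 1 0 0 0 1 0 (by simpa using t1) (by simpa using t2)
  have e2 := comp 1 0 0 0 0 1 (by simpa using t1) (by simpa using t3)
  have e3 := comp 0 0 1 0 1 0 (by simpa using t3) (by simpa using t2)
  obtain rfl : c₁ = 0 := by linarith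
  obtain rfl : c₂ = 0 := by linarith
  obtain rfl : c₃ = -1 := by linarith
  exact hP'

end InvariantPrimitive

/-! ### The radial profile, nondegeneracy and closedness -/

section Symplectic

open Set

/-- The profile `G` with `s G(s) = 1 - f(√s)`. -/
def profile (f : ℝ → ℝ) (s : ℝ) : ℝ := (1 - f √s) / s

section Profile

variable {f : ℝ → ℝ} {r₀ : ℝ}

/-- This covers negative `s` too: there `√s = 0` and `f 0 = 1`. The profile is therefore flat around
zero, and the division by `s` is harmless. -/
lemma profile_eventually_zero (hr₀ : 0 < r₀) (h1 : ∀ r, 0 ≤ r → r ≤ r₀ → f r = 1) {s : ℝ}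
    (hs : s < r₀ ^ 2) : profile f =ᶠ[𝓝 s] fun _ => 0 := by
  filter_upwards [Iio_mem_nhds hs] with t ht
  rw [profile, h1 _ (Real.sqrt_nonneg t) ((Real.sqrt_le_left hr₀.le).2 (le_of_lt ht)), sub_self,
    zero_div]

lemma contDiff_profile (hf : ContDiff ℝ ∞ f) (hr₀ : 0 < r₀)
    (h1 : ∀ r, 0 ≤ r → r ≤ r₀ → f r = 1) : ContDiff ℝ ∞ (profile f) := by
  rw [contDiff_iff_contDiffAt]
  intro s
  rcases lt_or_ge s (r₀ ^ 2) with hs | hs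
  · exact contDiffAt_const.congr_of_eventuallyEq (profile_eventually_zero hr₀ h1 hs)
  · have hs0 : s ≠ 0 := ((by positivity : 0 < r₀ ^ 2).trans_le hs).ne'
    exact (contDiffAt_const.sub (hf.contDiffAt.comp s (Real.contDiffAt_sqrt hs0))).div
      contDiffAt_id hs0

lemma profile_sq {r : ℝ} (hr : 0 ≤ r) (h0 : f 0 = 1) : 1 - r ^ 2 * profile f (r ^ 2) = f r := by
  rw [profile, Real.sqrt_sq hr]
  rcases hr.eq_or_lt with rfl | hr
  · simp [h0]
  · field_simp
    ring

/-- Differentiate `s G(s) = 1 - f(√s)` at `s = r²` and multiply by `2r`. -/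
lemma profile_deriv (hf : ContDiff ℝ ∞ f) (hr₀ : 0 < r₀)
    (h1 : ∀ r, 0 ≤ r → r ≤ r₀ → f r = 1) {r : ℝ} (hr : 0 < r) :
    r * (2 * r ^ 2 * deriv (profile f) (r ^ 2) + 2 * profile f (r ^ 2)) = -deriv f r := by
  have hr2 : (r ^ 2) ≠ 0 := by positivity
  have hG : HasDerivAt (profile f) (deriv (profile f) (r ^ 2)) (r ^ 2) :=
    ((contDiff_profile hf hr₀ h1).differentiable (by simp)).differentiableAt.hasDerivAt
  have e1 := (hasDerivAt_id (r ^ 2)).mul hG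
  have hfr : HasDerivAt f (deriv f r) √(r ^ 2) := by
    rw [Real.sqrt_sq hr.le]
    exact (hf.differentiable (by simp)).differentiableAt.hasDerivAt
  have e2 := (hfr.comp _ (Real.hasDerivAt_sqrt hr2)).const_sub 1
  have e3 := e1.unique (e2.congr_of_eventuallyEq (by
    filter_upwards [isOpen_ne.mem_nhds hr2] with s hs
    simp only [Pi.mul_apply, id, profile, Function.comp]
    field_simp))
  rw [Real.sqrt_sq hr.le] at e3
  simp only [id] at e3
  field_simp at e3
  linarith

/-- The smallness of `f f'` in the form in which it makes the magnetic form nondegenerate. -/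
lemma profile_nondegenerate (hf : ContDiff ℝ ∞ f) (hr₀ : 0 < r₀)
    (h1 : ∀ r, 0 ≤ r → r ≤ r₀ → f r = 1) (hff : ∀ r, 0 ≤ r → -r₀ < f r * deriv f r) {r : ℝ}
    (hr : 0 ≤ r) : 1 - (1 - r ^ 2 * profile f (r ^ 2)) *
      (2 * r ^ 2 * deriv (profile f) (r ^ 2) + 2 * profile f (r ^ 2)) ≠ 0 := by
  rcases lt_or_ge r r₀ with hlt | hge
  · have h := profile_eventually_zero hr₀ h1 (pow_lt_pow_left₀ hlt hr two_ne_zero)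
    rw [h.deriv_eq, h.eq_of_nhds, deriv_const]
    norm_num
  · have hr' : 0 < r := hr₀.trans_le hge
    have h := profile_deriv hf hr₀ h1 hr'
    rw [profile_sq hr (h1 0 le_rfl hr₀.le)]
    intro h0
    have h2 := hff r hr
    -- By `profile_deriv`, `r` times the quantity in question is `r + f f'`, which exceeds `r - r₀ ≥
    -- 0`.
    have h3 : r + f r * deriv f r = 0 := by linear_combination r * h0 + f r * h
    linarith

end Profile

lemma Frame.exists_coords_cotangent {x q n a b : V} (h : Frame x q n) {r : ℝ}
    (hab : (a, b) ∈ tangent cotangentSphere (x, r • q)) :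
    ∃ s c m t : ℝ, a = s • q + c • n ∧ b = -((r * s) • x) + m • q + t • n := by
  obtain ⟨h1, h2⟩ := tangent_cotangentSphere hab
  refine ⟨inner ℝ q a, inner ℝ n a, inner ℝ q b, inner ℝ n b, ?_, ?_⟩
  · conv_lhs => rw [h.expand a, h1]
    simp
  · rw [inner_smul_left] at h2
    conv_lhs => rw [h.expand b, show inner ℝ x b = -(r * inner ℝ q a) by
      simp only [conj_trivial] at h2; linarith]
    simp

/-- The magnetic form in a moving frame. -/
lemma magneticForm_frame {G : ℝ → ℝ} (hG : ContDiff ℝ ∞ G) {x q n : V} (h : Frame x q n)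
    (r s c m t s' c' m' t' : ℝ) :
    magneticForm G (x, r • q) ![(s • q + c • n, -((r * s) • x) + m • q + t • n),
      (s' • q + c' • n, -((r * s') • x) + m' • q + t' • n)] =
    (m * s' - m' * s) + (t * c' - t' * c) +
      (2 * r ^ 2 * deriv G (r ^ 2) + 2 * G (r ^ 2)) * (m * t' - m' * t) +
      (1 - r ^ 2 * G (r ^ 2)) * (s * c' - s' * c) := by
  have hr : inner ℝ (r • q) (r • q) = r ^ 2 := by
    rw [inner_smul_left, inner_smul_right, h.qq]
    simp [sq]
  rw [magneticForm_apply hG, hr]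
  simp only [map_add, map_neg, map_smul, add_apply, smul_apply, inner_add_left,
    inner_add_right, inner_neg_left, inner_neg_right, inner_smul_left, inner_smul_right, h.xx, h.qq,
    h.nn, h.xq, h.qx, h.xn, h.nx, h.qn, h.nq, h.cross_xq, h.cross_nq, h.cross_xn, cross_self,
    inner_zero_left, smul_neg]
  simp
  ring

/-- Pairing with the four frame vectors gives a linear system that decouples into one for `(s, t)`
and one for `(c, m)`. Both have determinant `1 - k w` up to sign, where `k = 1 - r² G` and `w = 2 r²
G' + 2 G`. -/
lemma magneticForm_nondegenerate {G : ℝ → ℝ} (hG : ContDiff ℝ ∞ G) {x q n : V}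
    (h : Frame x q n) {r : ℝ}
    (hw : 1 - (1 - r ^ 2 * G (r ^ 2)) * (2 * r ^ 2 * deriv G (r ^ 2) + 2 * G (r ^ 2)) ≠ 0)
    {u : V × V} (hu : u ∈ tangent cotangentSphere (x, r • q))
    (hv : ∀ v ∈ tangent cotangentSphere (x, r • q), magneticForm G (x, r • q) ![u, v] = 0) :
    u = 0 := by
  obtain ⟨a, b⟩ := u
  obtain ⟨s, c, m, t, rfl, rfl⟩ := h.exists_coords_cotangent hu
  have hmem := h.mem_cotangentSphere r
  have e1 := hv (0, q) (tangent_vertical hmem h.xq)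
  have e2 := hv (0, n) (tangent_vertical hmem h.xn)
  have e3 := hv (n, 0) (h.tangent_transverse fun x' h1 h2 =>
    ⟨h1, by rw [inner_smul_right, h2, mul_zero]⟩)
  have e4 := hv (q, -(r • x)) (h.tangent_geodesic fun x' q' h1 h2 h3 =>
    ⟨h1, by rw [inner_smul_right, h3, mul_zero]⟩)
  have f1 := magneticForm_frame hG h r s c m t 0 0 1 0
  have f2 := magneticForm_frame hG h r s c m t 0 0 0 1
  have f3 := magneticForm_frame hG h r s c m t 0 1 0 0
  have f4 := magneticForm_frame hG h r s c m t 1 0 0 0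
  simp only [zero_smul, one_smul, mul_zero, mul_one, neg_zero, add_zero, zero_add, e1, e2, e3, e4]
    at f1 f2 f3 f4
  generalize 2 * r ^ 2 * deriv G (r ^ 2) + 2 * G (r ^ 2) = w at *
  generalize 1 - r ^ 2 * G (r ^ 2) = k at *
  have ht : t = 0 := (mul_eq_zero.1 (by linear_combination -f3 - k * f1 :
    (1 - k * w) * t = 0)).resolve_left hw
  have hm : m = 0 := (mul_eq_zero.1 (by linear_combination -f4 + k * f2 :
    (1 - k * w) * m = 0)).resolve_left hw
  subst ht hm
  have hs : s = 0 := by linarith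
  have hc : c = 0 := by linarith
  subst hs hc
  simp

lemma triple_eq_zero {x a b c : V} (hx : inner ℝ x x = 1) (ha : inner ℝ x a = 0)
    (hb : inner ℝ x b = 0) (hc : inner ℝ x c = 0) : inner ℝ (cross a b) c = 0 := by
  have := congrArg (fun y => inner ℝ x y) (cramer a b c x)
  simpa [inner_add_right, inner_smul_right, ha, hb, hc, hx, -inner_self_eq_norm_sq_to_K] using this

/-- The ambient extension `det (x, ·, ·)` is not closed: its differential is a multiple of the
volume form of `ℝ³`. That vanishes on triples from the plane `x^⊥`. -/
lemma extDeriv_areaForm {x : V} (hx : inner ℝ x x = 1) {w : Fin 3 → V}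
    (hw : ∀ i, inner ℝ x (w i) = 0) : extDeriv areaForm x w = 0 := by
  have h : fderiv ℝ areaForm x = areaCLM := areaCLM.hasFDerivAt.fderiv
  rw [extDeriv, h, ContinuousAlternatingMap.alternatizeUncurryFin_apply]
  refine Finset.sum_eq_zero fun i _ => ?_
  have : areaCLM (w i) (i.removeNth w) = 0 := by
    change areaForm _ _ = 0
    rw [pair_eta (i.removeNth w), areaForm_eq]
    exact triple_eq_zero hx (hw _) (hw _) (hw _)
  rw [this, smul_zero]

lemma magneticForm_closed {G : ℝ → ℝ} (hG : ContDiff ℝ ∞ G) :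
    FormEqOn cotangentSphere (extDeriv (magneticForm G)) 0 := by
  intro z hz v hv
  have hθ := contDiff_oneForm (contDiff_coframe 1 0 hG)
  have e1 : extDeriv (magneticForm G) z = extDeriv (extDeriv (oneForm (coframe 1 0 G))) z +
      extDeriv (pullback Prod.fst areaForm) z :=
    extDeriv_fun_add ((contDiff_extDeriv hθ).contDiffAt.differentiableAt (by simp))
      (contDiff_pullback_fst_areaForm.contDiffAt.differentiableAt (by simp))
  rw [e1, extDeriv_extDeriv_apply hθ.contDiffAt
    (by rw [minSmoothness_of_isRCLikeNormedField]; exact WithTop.coe_le_coe.2 le_top), zero_add,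
    extDeriv_pullback_eq (contDiff_areaForm.contDiffAt.differentiableAt (by simp)) contDiffAt_fst,
    pullback_apply]
  refine extDeriv_areaForm (by rw [real_inner_self_eq_norm_sq, hz.1, one_pow]) fun i => ?_
  rw [fderiv_fst]
  exact (tangent_cotangentSphere (x := z.1) (p := z.2) (a := (v i).1) (b := (v i).2) (hv i)).1

lemma isSymplecticForm_magneticForm {f : ℝ → ℝ} {r₀ : ℝ} (hf : ContDiff ℝ ∞ f) (hr₀ : 0 < r₀)
    (h1 : ∀ r, 0 ≤ r → r ≤ r₀ → f r = 1) (hff : ∀ r, 0 ≤ r → -r₀ < f r * deriv f r) :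
    IsSymplecticForm cotangentSphere (magneticForm (profile f)) := by
  have hG := contDiff_profile hf hr₀ h1
  refine ⟨smoothNear_of_contDiff (contDiff_magneticForm hG), magneticForm_closed hG, ?_⟩
  intro z hz u hu hv
  obtain ⟨q, n, h, hq⟩ := exists_frame hz
  have hz' : z = (z.1, radius z • q) := Prod.ext rfl hq
  have hr : 0 ≤ radius z := norm_nonneg _
  generalize radius z = r at *
  generalize z.1 = x at *
  subst hz'
  exact magneticForm_nondegenerate hG h (profile_nondegenerate hf hr₀ h1 hff hr) hu hv

end Symplectic

/-! ### Comparison with the primitive off the zero section and with the Liouville form at infinity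
-/

section Extension

open Set

lemma differentiableAt_pullback {E F : Type*} [NormedAddCommGroup E] [NormedSpace ℝ E]
    [NormedAddCommGroup F] [NormedSpace ℝ F] {k : ℕ} {g : E → F} {θ : Form F k} {x : E}
    (hθ : DifferentiableAt ℝ θ (g x)) (hg : ContDiffAt ℝ ∞ g x) :
    DifferentiableAt ℝ (pullback g θ) x := by
  have h1 : DifferentiableAt ℝ (fun y => θ (g y)) x :=
    hθ.comp x (hg.differentiableAt (by simp))
  have h2 : DifferentiableAt ℝ (fderiv ℝ g) x :=
    (hg.fderiv_right (m := 1) (by exact WithTop.coe_le_coe.2 le_top)).differentiableAt (by simp)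
  exact (h1.hasFDerivAt.continuousAlternatingMapCompContinuousLinearMap
    h2.hasFDerivAt).differentiableAt

/-- The coefficient `c` of the radial direction can stay unspecified: `x × p` is orthogonal to `p`,
and the projection to the base ignores the fibre component. -/
lemma exists_fderiv_radialProjection {z : V × V} (hz : z.2 ≠ 0) (u : V × V) :
    ∃ c : ℝ, fderiv ℝ radialProjection z u = (u.1, ‖z.2‖⁻¹ • u.2 + c • z.2) := by
  have hr : DifferentiableAt ℝ (fun w : V × V => ‖w.2‖⁻¹) z :=
    (((contDiffAt_snd (n := ∞)).norm ℝ hz).inv (norm_ne_zero_iff.2 hz)).differentiableAt (by simp)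
  have h := (hasFDerivAt_fst (𝕜 := ℝ) (p := z)).prodMk (hr.hasFDerivAt.smul hasFDerivAt_snd)
  refine ⟨fderiv ℝ (fun w : V × V => ‖w.2‖⁻¹) z u, ?_⟩
  have h' : HasFDerivAt radialProjection _ z := h
  rw [h'.fderiv]
  simp

lemma pullback_radial_angularForm_apply {z : V × V} (hz : z.2 ≠ 0) (v : Fin 1 → V × V) :
    pullback radialProjection angularForm z v =
      -((‖z.2‖ ^ 2)⁻¹ * inner ℝ (cross z.1 z.2) (v 0).2) := by
  obtain ⟨c, hc⟩ := exists_fderiv_radialProjection hz (v 0)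
  rw [pullback_apply, angularForm, oneForm_apply, coframe_apply, hc]
  simp only [radialProjection, radius, map_smul, inner_smul_left, inner_smul_right, inner_add_right,
    inner_cross_right_self]
  simp only [conj_trivial]
  field_simp
  ring

lemma differentiableAt_liouvilleForm (z : V × V) : DifferentiableAt ℝ liouvilleForm z := by
  rw [liouvilleForm_eq]
  exact (contDiff_oneForm (contDiff_coframe 1 0 contDiff_const)).contDiffAt.differentiableAt
    (by simp)

lemma differentiableAt_magneticPrimitive {f : ℝ → ℝ} (hf : ContDiff ℝ ∞ f) {P : Form (V × V) 1}
    (hP : SmoothNear unitCotangentSphere P) {z : V × V} (hz : z ∈ puncturedCotangentSphere) :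
    DifferentiableAt ℝ (magneticPrimitive f P) z := by
  have hz2 := snd_ne_zero_of_mem hz
  have hfr : DifferentiableAt ℝ (fun w : V × V => f (radius w)) z :=
    (hf.contDiffAt.comp z (f := fun w : V × V => ‖w.2‖)
      ((contDiffAt_snd (n := ∞)).norm ℝ hz2)).differentiableAt (by simp)
  exact (differentiableAt_liouvilleForm z).add (hfr.smul (differentiableAt_pullback
    ((hP.contDiffAt (radialProjection_mem hz)).differentiableAt (by simp))
    (contDiffAt_radialProjection hz2)))

/-- The magnetic form is the exterior derivative of the magnetic primitive away from the zero
section. -/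
lemma magneticForm_eq_extDeriv {f : ℝ → ℝ} {r₀ : ℝ} (hf : ContDiff ℝ ∞ f) (hr₀ : 0 < r₀)
    (h1 : ∀ r, 0 ≤ r → r ≤ r₀ → f r = 1) {P : Form (V × V) 1} (hP : IsInvariantPrimitive P) :
    FormEqOn puncturedCotangentSphere (magneticForm (profile f))
      (extDeriv (magneticPrimitive f P)) := by
  have hG := contDiff_profile hf hr₀ h1
  have hrad : ∀ z ∈ puncturedCotangentSphere, ContDiffAt ℝ ∞ radialProjection z :=
    fun z hz => contDiffAt_radialProjection (snd_ne_zero_of_mem hz)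
  have hmaps : MapsTo radialProjection puncturedCotangentSphere unitCotangentSphere :=
    fun z hz => radialProjection_mem hz
  have hang : ∀ z ∈ puncturedCotangentSphere,
      DifferentiableAt ℝ (pullback radialProjection angularForm) z := fun z hz =>
    differentiableAt_pullback (contDiff_angularForm.contDiffAt.differentiableAt (by simp))
      (hrad z hz)
  have hco : ∀ z, DifferentiableAt ℝ (oneForm (coframe 1 0 (profile f))) z := fun z =>
    (contDiff_oneForm (contDiff_coframe 1 0 hG)).contDiffAt.differentiableAt (by simp)
  -- By uniqueness `P` may be replaced by `angularForm`; the identity is then `f = 1 - r² G` in the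
  -- coefficient of (x × p)·dp.
  have hprim : FormEqOn puncturedCotangentSphere (fun z => oneForm (coframe 1 0 (profile f)) z +
      pullback radialProjection angularForm z) (magneticPrimitive f P) := by
    intro z hz v hv
    have hr : ‖z.2‖ ≠ 0 := hz.2
    have hPv := hP.eq_angularForm.pullback hrad hmaps z hz v hv
    rw [magneticPrimitive, ContinuousAlternatingMap.add_apply, ContinuousAlternatingMap.add_apply,
      ContinuousAlternatingMap.smul_apply, hPv,
      pullback_radial_angularForm_apply (snd_ne_zero_of_mem hz), liouvilleForm_eq, oneForm_apply,
      oneForm_apply, coframe_apply, coframe_apply, real_inner_self_eq_norm_sq, profile,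
      Real.sqrt_sq (norm_nonneg _), radius, smul_eq_mul]
    field_simp
    ring
  refine FormEqOn.trans ?_ (hprim.extDeriv localRetract_punctured
    (fun z hz => (hco z).add (hang z hz))
    fun z hz => differentiableAt_magneticPrimitive hf hP.1 hz)
  intro z hz v hv
  have hz2 := snd_ne_zero_of_mem hz
  rw [extDeriv_fun_add (hco z) (hang z hz), magneticForm, ContinuousAlternatingMap.add_apply,
    ContinuousAlternatingMap.add_apply, extDeriv_pullback_eq
      (contDiff_angularForm.contDiffAt.differentiableAt (by simp)) (hrad z hz),
    isInvariantPrimitive_angularForm.2.1.pullback hrad hmaps z hz v hv, pullback_apply,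
    pullback_apply, pullback_apply, fderiv_fst, fderiv_fst]
  -- Radial projection covers the identity of the sphere, so pulling π^*σ back along it gives π^*σ
  -- again.
  congr 2
  ext i : 1
  obtain ⟨c, hc⟩ := exists_fderiv_radialProjection hz2 (v i)
  rw [hc]
  rfl

lemma magneticForm_eq_liouville {f : ℝ → ℝ} {r₀ R : ℝ} (hf : ContDiff ℝ ∞ f) (hr₀ : 0 < r₀)
    (h1 : ∀ r, 0 ≤ r → r ≤ r₀ → f r = 1) (hR0 : 0 ≤ R) (hR : ∀ r, R ≤ r → f r = 0) :
    FormEqOn {z ∈ cotangentSphere | R < radius z} (magneticForm (profile f))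
      (extDeriv liouvilleForm) := by
  have hsub : {z ∈ cotangentSphere | R < radius z} ⊆ puncturedCotangentSphere :=
    fun z hz => ⟨hz.1, (hR0.trans_lt hz.2).ne'⟩
  refine ((magneticForm_eq_extDeriv hf hr₀ h1 isInvariantPrimitive_angularForm).mono hsub).trans ?_
  intro z hz v _
  have hev : magneticPrimitive f angularForm =ᶠ[𝓝 z] liouvilleForm := by
    have hopen : IsOpen {w : V × V | R < radius w} :=
      isOpen_lt continuous_const continuous_snd.norm
    filter_upwards [hopen.mem_nhds hz.2] with w hw
    rw [magneticPrimitive, hR _ (le_of_lt hw), zero_smul, add_zero]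
  rw [hev.extDeriv_eq]

end Extension

/-! ### The symplectization end and the filling property -/

section Filling

open Set

/-- The end of the cotangent bundle in terms of the symplectization: the flow of the Liouville
field starting at radius `c`. -/
def endMap (c : ℝ) (w : ℝ × (V × V)) : V × V := (w.2.1, (c * Real.exp w.1) • w.2.2)

/-- The inverse of `endMap`. -/
def endInverse (c : ℝ) (z : V × V) : ℝ × (V × V) := (Real.log (radius z / c), radialProjection z)

lemma contDiff_endMap (c : ℝ) : ContDiff ℝ ∞ (endMap c) := by
  unfold endMap
  fun_prop

variable {c : ℝ}

lemma radius_endMap (hc : 0 < c) (s : ℝ) {y : V × V} (hy : y ∈ unitCotangentSphere) :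
    radius (endMap c (s, y)) = c * Real.exp s := by
  have h1 : ‖y.2‖ = 1 := hy.2
  simp only [radius, endMap, norm_smul, h1, mul_one]
  rw [Real.norm_of_nonneg (by positivity)]

lemma endMap_mem (s : ℝ) {y : V × V} (hy : y ∈ unitCotangentSphere) :
    endMap c (s, y) ∈ cotangentSphere :=
  ⟨hy.1.1, by simp [endMap, inner_smul_right, hy.1.2]⟩

lemma endInverse_endMap (hc : 0 < c) (s : ℝ) {y : V × V} (hy : y ∈ unitCotangentSphere) :
    endInverse c (endMap c (s, y)) = (s, y) := by
  have hr := radius_endMap hc s hy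
  have h0 : c * Real.exp s ≠ 0 := by positivity
  rw [endInverse, radialProjection, hr, mul_div_cancel_left₀ _ hc.ne', Real.log_exp]
  simp only [endMap]
  rw [smul_smul, inv_mul_cancel₀ h0, one_smul]

lemma endMap_endInverse (hc : 0 < c) {z : V × V} (hz : 0 < radius z) :
    endMap c (endInverse c z) = z := by
  simp only [endMap, endInverse, radialProjection]
  rw [Real.exp_log (by positivity), smul_smul]
  rw [mul_div_cancel₀ _ hc.ne', mul_inv_cancel₀ hz.ne', one_smul]

lemma endInverse_snd_mem {z : V × V} (hz : z ∈ cotangentSphere) (hr : 0 < radius z) :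
    (endInverse c z).2 ∈ unitCotangentSphere :=
  radialProjection_mem ⟨hz, hr.ne'⟩

lemma image_endMap (hc : 0 < c) (a : ℝ) : endMap c '' (Ioi a ×ˢ unitCotangentSphere) =
    cotangentSphere ∩ {z | c * Real.exp a < radius z} := by
  ext z
  constructor
  · rintro ⟨⟨s, y⟩, ⟨hs, hy⟩, rfl⟩
    refine ⟨endMap_mem s hy, ?_⟩
    rw [mem_ofPred_eq, radius_endMap hc s hy]
    exact mul_lt_mul_of_pos_left (Real.exp_lt_exp.2 hs) hc
  · rintro ⟨hz, hr⟩
    have hr0 : 0 < radius z := lt_trans (by positivity) hr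
    refine ⟨endInverse c z, ⟨?_, endInverse_snd_mem hz hr0⟩, endMap_endInverse hc hr0⟩
    simp only [endInverse, mem_Ioi]
    rw [Real.lt_log_iff_exp_lt (by positivity), lt_div_iff₀ hc, mul_comm]
    exact hr

lemma isClosed_cotangentSphere : IsClosed cotangentSphere :=
  (isClosed_eq continuous_fst.norm continuous_const).inter
    (isClosed_eq (continuous_fst.inner continuous_snd) continuous_const)

lemma continuous_radius : Continuous radius := continuous_snd.norm

lemma isCompact_radius_le (c : ℝ) : IsCompact {z ∈ cotangentSphere | radius z ≤ c} := by
  refine Metric.isCompact_of_isClosed_isBounded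
    (isClosed_cotangentSphere.inter (isClosed_le continuous_radius continuous_const)) ?_
  refine Metric.isBounded_closedBall (x := (0 : V × V)) (r := max 1 c) |>.subset fun z hz => ?_
  rw [mem_closedBall_zero_iff, Prod.norm_def]
  exact max_le_max hz.1.1.le hz.2

lemma isCompact_unitCotangentSphere : IsCompact unitCotangentSphere :=
  (isCompact_radius_le 1).of_isClosed_subset
    (isClosed_cotangentSphere.inter (isClosed_eq continuous_radius continuous_const))
    fun _ hz => ⟨hz.1, le_of_eq hz.2⟩

/-- The Liouville form is homogeneous of degree one in the fibre and has no `dp` component, so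
scaling by `c e^s` only multiplies it. -/
lemma pullback_endMap_liouvilleForm (c : ℝ) : pullback (endMap c) liouvilleForm =
    fun w => Real.exp w.1 • pullback Prod.snd (fun y => c • liouvilleForm y) w := by
  ext w v
  have h1 : ∀ u, (fderiv ℝ (endMap c) w u).1 = u.2.1 := fun u => by
    have h2 := (ContinuousLinearMap.fst ℝ V V).hasFDerivAt.comp w
      ((contDiff_endMap c).differentiable (by simp) w).hasFDerivAt
    have h3 : HasFDerivAt (fun w : ℝ × (V × V) => w.2.1) ((ContinuousLinearMap.fst ℝ V V).comp
        (ContinuousLinearMap.snd ℝ ℝ (V × V))) w :=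
      ((ContinuousLinearMap.fst ℝ V V).comp (ContinuousLinearMap.snd ℝ ℝ (V × V))).hasFDerivAt
    exact congrArg (fun T => T u) (h2.unique h3)
  rw [pullback_apply, ContinuousAlternatingMap.smul_apply, pullback_apply,
    ContinuousAlternatingMap.smul_apply, liouvilleForm_eq, oneForm_apply, oneForm_apply,
    coframe_apply, coframe_apply, h1, fderiv_snd]
  simp only [endMap, inner_smul_left, conj_trivial, smul_eq_mul, ContinuousLinearMap.coe_snd']
  ring

lemma isFilling_of_eq_liouville {Ω : Form (V × V) 2} (hΩ : IsSymplecticForm cotangentSphere Ω)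
    {R : ℝ} (hR : 0 < R)
    (hend : FormEqOn {z ∈ cotangentSphere | R < radius z} Ω (extDeriv liouvilleForm)) :
    IsFilling cotangentSphere Ω unitCotangentSphere liouvilleForm := by
  -- The starting radius is `R e`, so that the collar of width `ε = 1` reaches down exactly to
  -- radius `R`, beyond which the form is dλ. The contact form is `R e` times the Liouville form.
  have hc : 0 < R * Real.exp 1 := by positivity
  have himg := image_endMap hc
  have hexp : R * Real.exp 1 * Real.exp (-1) = R := by
    rw [mul_assoc, ← Real.exp_add]
    simp
  refine ⟨hΩ, isCompact_unitCotangentSphere, fun _ => R * Real.exp 1, 1, endMap (R * Real.exp 1),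
    endInverse (R * Real.exp 1), smoothNear_of_contDiff contDiff_const, fun _ _ => hc, one_pos,
    smoothNear_of_contDiff (contDiff_endMap _), ?_, ?_, ?_, ?_, ?_, ?_⟩
  · refine ⟨{z | z.2 ≠ 0}, isOpen_ne.preimage continuous_snd, ?_, ?_⟩
    · rw [himg]
      rintro z ⟨-, hz⟩
      exact norm_ne_zero_iff.1 (lt_trans (by positivity) hz : 0 < radius z).ne'
    · intro z hz
      have hz' : ‖z.2‖ ≠ 0 := norm_ne_zero_iff.2 hz
      exact (((((contDiffAt_snd (n := ∞)).norm ℝ hz).div_const _).log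
        (div_ne_zero hz' hc.ne')).prodMk (contDiffAt_radialProjection hz)).contDiffWithinAt
  · rintro ⟨s, y⟩ ⟨-, hy⟩
    exact endInverse_endMap hc s hy
  · exact ⟨_, isOpen_lt continuous_const continuous_radius, himg _⟩
  · have hmaps : MapsTo (endMap (R * Real.exp 1)) (Ioi (-1) ×ˢ unitCotangentSphere)
        {z ∈ cotangentSphere | R < radius z} := by
      rw [mapsTo_iff_image_subset, himg, hexp]
      exact fun z hz => hz
    refine (hend.pullback (fun w _ => (contDiff_endMap _).contDiffAt) hmaps).trans ?_
    intro w _ v _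
    rw [← extDeriv_pullback_eq (differentiableAt_liouvilleForm _) (contDiff_endMap _).contDiffAt,
      pullback_endMap_liouvilleForm]
    rfl
  · rw [himg, Real.exp_zero, mul_one]
    have hset : cotangentSphere \ (cotangentSphere ∩ {z | R * Real.exp 1 < radius z}) =
        {z ∈ cotangentSphere | radius z ≤ R * Real.exp 1} := by
      ext z
      exact ⟨fun h => ⟨h.1, not_lt.1 fun h' => h.2 ⟨h.1, h'⟩⟩,
        fun h => ⟨h.1, fun h' => absurd h'.2 (not_lt.2 h.2)⟩⟩
    rw [hset]
    exact isCompact_radius_le _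
  · intro K _ hK
    obtain ⟨B, hB⟩ := (hK.image continuous_radius).isBounded.bddAbove
    -- With `c = R e`, a point with `c s ≥ |B|` has radius `c e^s ≥ c (s + 1) > B`, beyond the
    -- maximal radius on `K`.
    refine ⟨|B| / (R * Real.exp 1), by positivity, ?_⟩
    rw [Set.disjoint_left]
    rintro _ hzK ⟨⟨s, y⟩, ⟨hs, hy⟩, rfl⟩
    have h1 := hB (mem_image_of_mem radius hzK)
    rw [radius_endMap hc s hy] at h1
    rw [mem_Ici, div_le_iff₀ hc] at hs
    have h2 := mul_le_mul_of_nonneg_left (Real.add_one_le_exp s) hc.le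
    have h3 := le_abs_self B
    linarith

end Filling

end MagneticSphere

end

open MagneticSphere
theorem lemma1p7 :
    (∃ P : Form (V × V) 1, IsInvariantPrimitive P) ∧
    ∀ r₀ : ℝ, 0 < r₀ → ∃ δ₀ : ℝ, 0 < δ₀ ∧
      ∀ (δ : ℝ) (f : ℝ → ℝ) (P : Form (V × V) 1),
        0 < δ → δ ≤ δ₀ →
        ContDiff ℝ ∞ f → (∀ r, 0 ≤ r → r ≤ r₀ → f r = 1) → (∃ R, ∀ r, R ≤ r → f r = 0) →
        (∀ r, 0 ≤ r → -δ < f r * deriv f r ∧ f r * deriv f r < δ) →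
        IsInvariantPrimitive P →
        ∃ Ω : Form (V × V) 2,
          -- `Ω` is the smooth extension of `d(λ + f(r) P)` across the zero section
          FormEqOn puncturedCotangentSphere Ω (extDeriv (magneticPrimitive f P)) ∧
          IsSymplecticForm cotangentSphere Ω ∧
          (∃ R : ℝ, FormEqOn {z ∈ cotangentSphere | R < radius z} Ω (extDeriv liouvilleForm)) ∧
          IsFilling cotangentSphere Ω unitCotangentSphere liouvilleForm := by
  refine ⟨⟨angularForm, isInvariantPrimitive_angularForm⟩, fun r₀ hr₀ => ⟨r₀, hr₀, ?_⟩⟩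
  rintro δ f P - hδ hf h1 ⟨R, hR⟩ hff hP
  have hsymp := isSymplecticForm_magneticForm hf hr₀ h1 fun r hr => by
    linarith [(hff r hr).1]
  -- The given `R` may be nonpositive, while the end must start at a positive radius.
  have hpos : 0 < max R 1 := lt_max_of_lt_right one_pos
  have hend := magneticForm_eq_liouville hf hr₀ h1 hpos.le
    fun r hr => hR r ((le_max_left _ _).trans hr)
  exact ⟨_, magneticForm_eq_extDeriv hf hr₀ h1 hP, hsymp, ⟨_, hend⟩,
    isFilling_of_eq_liouville hsymp hpos hend⟩
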